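/- Let $d\in\{1,2,\dots\}$, $T>0$, $\lambda>0$, let $(\mathsf b_{\mathsf m})_{\mathsf m\in\mathbb N^d}\subset\mathbb R^d$ be an arbitrary sequence, and let $$g_\lambda(x,t,y)=\Big(\frac{2\pi\sinh(\lambda t)}{\lambda}\Big)^{-d/2}\exp\Big[-\frac{\lambda\big(\cosh(\lambda t)(|x|^2+|y|^2)-2(x,y)\big)}{2\sinh(\lambda t)}\Big]$$ be Mehler's kernel. It is a Green function of $\partial_t u=\frac12\Delta u-\frac{\lambda^2}{2}|x|^2u$ on $\mathbb R^d\times(0,T]$: it is positive, symmetric in $x,y$, twice continuously differentiable in $x$, solves the equation in $(x,t)$ for every $y$, satisfies $\int g_\lambda(x,s,z)g_\lambda(z,t,y)\,dz=g_\lambda(x,s+t,y)$ for $s,t>0$, $s+t\le T$, and $g_\lambda(x,t,y)\,dx\to\delta_y$ weakly as $t\to0_+$. Fix $\mathsf m\in\mathbb N^d$ and let $\varphi=\mathcal N\delta(x)$, $\psi=\mathcal N\delta(x-\mathsf b_{\mathsf m})$ with $\mathcal N=\big(\frac{2\pi\sinh(\lambda T)}{\lambda}\big)^{d/4}\exp\big[\frac{\lambda\coth(\lambda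 T)|\mathsf b_{\mathsf m}|^2}{4}\big]$, and $\mu_{\mathsf m}(dx,dy)=\varphi(dx)\,g_\lambda(x,T,y)\,\psi(dy)$. Let $Z=Z^{\mathsf m,\lambda}_{\tau\in[0,T]}$ be the associated Bernstein process. That is, $Z$ is an $\mathbb R^d$-valued process on a probability space $(\Omega,\mathcal F,\mathbb P)$ such that * for all $0\le s<r<t\le T$ and every bounded Borel $f:\mathbb R^d\to\mathbb C$, almost surely $\mathbb E(f(Z_r)\mid\sigma(Z_\tau:\tau\le s\text{ or }\tau\ge t))=\mathbb E(f(Z_r)\mid Z_s,Z_t)$; * for all $0\le s<r<t\le T$ and every Borel set $F$, almost surely $$\mathbb P(Z_r\in F\mid Z_s,Z_t)=\int_F\frac{g_\lambda(Z_t,t-r,z)\,g_\lambda(z,r-s,Z_s)}{g_\lambda(Z_t,t-s,Z_s)}\,dz ;$$ * $(Z_0,Z_T)$ has the law $\mu_{\mathsf m}$. Such a process exists on some complete probability space. Every such process is Gaussian, Markovian and non-stationary (its finite-dimensional distributions at times in $(0,T)$ are not invariant under the time shifts that keep these times in $(0,T)$), and, with $$\mathsf b_{\mathsf m,\lambda}(t)=\frac{\sinh(\lambda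 t)}{\sinh(\lambda T)}\mathsf b_{\mathsf m},\qquad \sigma_\lambda(t)=\frac{\sinh(\lambda(T-t))\sinh(\lambda t)}{\lambda\sinh(\lambda T)},$$ the following hold. (a) For every $t\in(0,T)$ and every Borel set $F\subset\mathbb R^d$, $$\mathbb P(Z_t\in F)=(2\pi\sigma_\lambda(t))^{-d/2}\int_F\exp\Big[-\frac{|x-\mathsf b_{\mathsf m,\lambda}(t)|^2}{2\sigma_\lambda(t)}\Big]dx .$$ Moreover $\mathbb P(Z_0=0)=\mathbb P(Z_T=\mathsf b_{\mathsf m})=1$, and $\mathbb E(Z_t)=\mathsf b_{\mathsf m,\lambda}(t)$ for every $t\in[0,T]$. (b) For all $s,t\in[0,T]$ and $i,j\in\{1,\dots,d\}$, the product $(Z^i_s-b^i_{\mathsf m,\lambda}(s))(Z^j_t-b^j_{\mathsf m,\lambda}(t))$ is integrable and $$\mathbb E\big((Z^i_s-b^i_{\mathsf m,\lambda}(s))(Z^j_t-b^j_{\mathsf m,\lambda}(t))\big)=\begin{cases}\dfrac{\sinh(\lambda(T-t))\sinh(\lambda s)}{\lambda\sinh(\lambda T)}\,\delta_{i,j}&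 t\ge s,\\[2mm] \dfrac{\sinh(\lambda(T-s))\sinh(\lambda t)}{\lambda\sinh(\lambda T)}\,\delta_{i,j}& t\le s.\end{cases}$$ (c) For every bounded Borel function $f:\mathbb R^d\to\mathbb C$ and every $t\in(0,T)$, $$\mathbb E(f(Z_t))=(2\pi\sigma_\lambda(t))^{-d/2}\int_{\mathbb R^d}f(x)\exp\Big[-\frac{|x-\mathsf b_{\mathsf m,\lambda}(t)|^2}{2\sigma_\lambda(t)}\Big]dx .$$ -/

import Mathlib

open MeasureTheory ProbabilityTheory Filter Topology

noncomputable section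

/-! ### Processes indexed by `[0, T]` -/

section Processes

variable {Ω : Type*} {d : ℕ} {T : ℝ}

/-- The sigma-algebra generated by the process up to time `s`. -/
abbrev pastField (Z : Set.Icc (0 : ℝ) T → Ω → EuclideanSpace ℝ (Fin d)) (s : Set.Icc (0 : ℝ) T) :
    MeasurableSpace Ω :=
  ⨆ (τ : Set.Icc (0 : ℝ) T) (_ : τ ≤ s), MeasurableSpace.comap (Z τ) inferInstance

/-- The sigma-algebra generated by the process from time `t` on. -/
abbrev futureField (Z : Set.Icc (0 : ℝ) T → Ω → EuclideanSpace ℝ (Fin d)) (t : Set.Icc (0 : ℝ) T) :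
    MeasurableSpace Ω :=
  ⨆ (τ : Set.Icc (0 : ℝ) T) (_ : t ≤ τ), MeasurableSpace.comap (Z τ) inferInstance

/-- The sigma-algebra generated by the position at time `s`. -/
abbrev presentField (Z : Set.Icc (0 : ℝ) T → Ω → EuclideanSpace ℝ (Fin d)) (s : Set.Icc (0 : ℝ) T) :
    MeasurableSpace Ω :=
  MeasurableSpace.comap (Z s) inferInstance

variable [MeasurableSpace Ω]

/-- Bernstein (reciprocal) property: for `s < r < t`, given the whole past of `s` and the whole
future of `t`, the conditional law of the position at time `r` depends on the positions at the
times `s` and `t` only. -/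
def HasBernsteinProperty (Z : Set.Icc (0 : ℝ) T → Ω → EuclideanSpace ℝ (Fin d))
    (P : Measure Ω) : Prop :=
  ∀ s r t : Set.Icc (0 : ℝ) T, s < r → r < t →
    ∀ b : EuclideanSpace ℝ (Fin d) → ℂ, Measurable b → (∃ C : ℝ, ∀ x, ‖b x‖ ≤ C) →
      P[fun ω ↦ b (Z r ω) | pastField Z s ⊔ futureField Z t]
        =ᵐ[P] P[fun ω ↦ b (Z r ω) | presentField Z s ⊔ presentField Z t]

/-- Markov property: given the whole past of `s`, the conditional law of the position at a later
time `t` depends on the position at time `s` only. -/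
def HasMarkovProperty (Z : Set.Icc (0 : ℝ) T → Ω → EuclideanSpace ℝ (Fin d))
    (P : Measure Ω) : Prop :=
  ∀ s t : Set.Icc (0 : ℝ) T, s < t →
    ∀ b : EuclideanSpace ℝ (Fin d) → ℂ, Measurable b → (∃ C : ℝ, ∀ x, ‖b x‖ ≤ C) →
      P[fun ω ↦ b (Z t ω) | pastField Z s] =ᵐ[P] P[fun ω ↦ b (Z t ω) | presentField Z s]

/-- Stationarity in the open time interval: the finite-dimensional distributions at times in
`(0, T)` do not change under a time shift which keeps these times in `(0, T)`. -/
def IsStationaryProcess (Z : Set.Icc (0 : ℝ) T → Ω → EuclideanSpace ℝ (Fin d))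
    (P : Measure Ω) : Prop :=
  ∀ (n : ℕ) (τ : ℝ) (t t' : Fin n → Set.Icc (0 : ℝ) T),
    (∀ k, (t k : ℝ) ∈ Set.Ioo 0 T) → (∀ k, (t' k : ℝ) ∈ Set.Ioo 0 T) →
    (∀ k, (t' k : ℝ) = t k + τ) →
      P.map (fun ω k ↦ Z (t' k) ω) = P.map (fun ω k ↦ Z (t k) ω)

end Processes

/-! ### Green functions and the Bernstein processes they generate -/

section Green

variable {d : ℕ}

/-- `g (x, t, y)` is a Green function (fundamental solution) on `(0, T]` for the parabolic
equation `∂ₜ u = (1/2) Δ u - V u` in `ℝᵈ`. -/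
structure IsGreenFunction (V : EuclideanSpace ℝ (Fin d) → ℝ) (T : ℝ)
    (g : EuclideanSpace ℝ (Fin d) → ℝ → EuclideanSpace ℝ (Fin d) → ℝ) : Prop where
  pos : ∀ t ∈ Set.Ioc 0 T, ∀ x y, 0 < g x t y
  symm : ∀ t ∈ Set.Ioc 0 T, ∀ x y, g x t y = g y t x
  contDiff : ∀ t ∈ Set.Ioc 0 T, ∀ y, ContDiff ℝ 2 (fun x ↦ g x t y)
  equation : ∀ t ∈ Set.Ioc 0 T, ∀ x y,
    HasDerivWithinAt (fun t' ↦ g x t' y)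
      ((1 / 2) * Laplacian.laplacian (fun x' ↦ g x' t y) x - V x * g x t y) (Set.Ioc 0 T) t
  composition : ∀ s > 0, ∀ t > 0, s + t ≤ T → ∀ x y, ∫ z, g x s z * g z t y = g x (s + t) y
  initial : ∀ y, ∀ f : BoundedContinuousFunction (EuclideanSpace ℝ (Fin d)) ℝ,
    Tendsto (fun t ↦ ∫ x, g x t y * f x) (𝓝[>] 0) (𝓝 (f y))

/-- The two-sided transition function `Q (x, t; F, r; y, s)` built on the kernel `g`. -/
def twoSidedTransition (g : EuclideanSpace ℝ (Fin d) → ℝ → EuclideanSpace ℝ (Fin d) → ℝ)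
    (x : EuclideanSpace ℝ (Fin d)) (t : ℝ) (F : Set (EuclideanSpace ℝ (Fin d))) (r : ℝ)
    (y : EuclideanSpace ℝ (Fin d)) (s : ℝ) : ℝ :=
  ∫ z in F, g x (t - r) z * g z (r - s) y / g x (t - s) y

/-- The measure `φ(dx) g(x, T, y) ψ(dy)` generated by the initial datum `φ` and the final
datum `ψ`. -/
def endpointMeasure (g : EuclideanSpace ℝ (Fin d) → ℝ → EuclideanSpace ℝ (Fin d) → ℝ) (T : ℝ)
    (φ ψ : Measure (EuclideanSpace ℝ (Fin d))) :
    Measure (EuclideanSpace ℝ (Fin d) × EuclideanSpace ℝ (Fin d)) :=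
  (φ.prod ψ).withDensity (fun p ↦ ENNReal.ofReal (g p.1 T p.2))

/-- `Z` is, under `P`, a Bernstein process with two-sided transition function built on `g` and
with joint distribution `μ` of its initial and final positions. -/
structure IsBernsteinProcess {Ω : Type*} [MeasurableSpace Ω] {T : ℝ} (hT : 0 ≤ T)
    (g : EuclideanSpace ℝ (Fin d) → ℝ → EuclideanSpace ℝ (Fin d) → ℝ)
    (μ : Measure (EuclideanSpace ℝ (Fin d) × EuclideanSpace ℝ (Fin d)))
    (Z : Set.Icc (0 : ℝ) T → Ω → EuclideanSpace ℝ (Fin d)) (P : Measure Ω) : Prop where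
  measurable : ∀ t, Measurable (Z t)
  bernstein : HasBernsteinProperty Z P
  transition : ∀ s r t : Set.Icc (0 : ℝ) T, s < r → r < t →
    ∀ F : Set (EuclideanSpace ℝ (Fin d)), MeasurableSet F →
      P⟦Z r ⁻¹' F | presentField Z s ⊔ presentField Z t⟧
        =ᵐ[P] fun ω ↦ twoSidedTransition g (Z t ω) t F r (Z s ω) s
  endpoints : P.map (fun ω ↦
    (Z ⟨0, Set.left_mem_Icc.2 hT⟩ ω, Z ⟨T, Set.right_mem_Icc.2 hT⟩ ω)) = μ

end Green

/-! ### The harmonic oscillator -/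

section Oscillator

variable {d : ℕ}

/-- The potential of the isotropic harmonic oscillator. -/
def oscillatorPotential (lam : ℝ) (x : EuclideanSpace ℝ (Fin d)) : ℝ :=
  lam ^ 2 / 2 * ‖x‖ ^ 2

/-- Mehler's `d`-dimensional kernel. -/
def mehlerKernel (lam : ℝ) (x : EuclideanSpace ℝ (Fin d)) (t : ℝ)
    (y : EuclideanSpace ℝ (Fin d)) : ℝ :=
  (2 * Real.pi * Real.sinh (lam * t) / lam) ^ (-(d : ℝ) / 2) *
    Real.exp (-(lam * (Real.cosh (lam * t) * (‖x‖ ^ 2 + ‖y‖ ^ 2) - 2 * inner ℝ x y)) /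
      (2 * Real.sinh (lam * t)))

/-- The normalization constant of the data for the final point `b`. -/
def bridgeNormalization (lam T : ℝ) (b : EuclideanSpace ℝ (Fin d)) : ℝ :=
  (2 * Real.pi * Real.sinh (lam * T) / lam) ^ ((d : ℝ) / 4) *
    Real.exp (lam * (Real.cosh (lam * T) / Real.sinh (lam * T)) * ‖b‖ ^ 2 / 4)

/-- The initial datum: a multiple of the Dirac measure at the origin. -/
def bridgeInitialDatum (lam T : ℝ) (b : EuclideanSpace ℝ (Fin d)) :
    Measure (EuclideanSpace ℝ (Fin d)) :=
  ENNReal.ofReal (bridgeNormalization lam T b) • Measure.dirac 0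

/-- The final datum: the same multiple of the Dirac measure at `b`. -/
def bridgeFinalDatum (lam T : ℝ) (b : EuclideanSpace ℝ (Fin d)) :
    Measure (EuclideanSpace ℝ (Fin d)) :=
  ENNReal.ofReal (bridgeNormalization lam T b) • Measure.dirac b

/-- `Z` is, under `P`, the Bernstein bridge of the harmonic oscillator for the data
`N δ(x)` and `N δ(x - b)`. -/
def IsOscillatorBridge {Ω : Type*} [MeasurableSpace Ω] {T : ℝ} (hT : 0 < T) (lam : ℝ)
    (b : EuclideanSpace ℝ (Fin d))
    (Z : Set.Icc (0 : ℝ) T → Ω → EuclideanSpace ℝ (Fin d)) (P : Measure Ω) : Prop :=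
  IsBernsteinProcess hT.le (mehlerKernel lam)
    (endpointMeasure (mehlerKernel lam) T (bridgeInitialDatum lam T b) (bridgeFinalDatum lam T b))
    Z P

/-- The mean vector at time `t`. -/
def bridgeMean (lam T : ℝ) (b : EuclideanSpace ℝ (Fin d)) (t : ℝ) : EuclideanSpace ℝ (Fin d) :=
  (Real.sinh (lam * t) / Real.sinh (lam * T)) • b

/-- The variance of each component at time `t`. -/
def bridgeVariance (lam T t : ℝ) : ℝ :=
  Real.sinh (lam * (T - t)) * Real.sinh (lam * t) / (lam * Real.sinh (lam * T))

/-- The Gaussian density at time `t`. -/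
def bridgeDensity (lam T : ℝ) (b : EuclideanSpace ℝ (Fin d)) (t : ℝ)
    (x : EuclideanSpace ℝ (Fin d)) : ℝ :=
  (2 * Real.pi * bridgeVariance lam T t) ^ (-(d : ℝ) / 2) *
    Real.exp (-(‖x - bridgeMean lam T b t‖ ^ 2) / (2 * bridgeVariance lam T t))

end Oscillator

end

/-!
Everything rests on the linear interpolation of the bridge. Completing the square in the product of
two Mehler kernels shows that the two-sided transition function is Gaussian: given the positions
`y` at time `s` and `x` at time `t`, the position at time `r` has mean `A y + B x`, with
`A = sinh (λ (t - r)) / sinh (λ (t - s))` and `B = sinh (λ (r - s)) / sinh (λ (t - s))`, and variance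
`bridgeVariance λ (t - s) (r - s)` (`twoSidedTransition_mehlerKernel`). The same completion of the
square gives the semigroup law, and the remaining properties of a Green function are direct
computations (`isGreenFunction_mehlerKernel`).

Properties of an arbitrary realization. The endpoint measure is the Dirac measure at `(0, b)`, so
that the final position is deterministic, and conditioning on the past alone is the Bernstein
property with `t = T`. Since the conditional variance does not depend on the conditioning, the
innovation `Z r - E (Z r | past of s)` is a Gaussian vector independent of the past
(`IsOscillatorBridge.indep_innovation`, by way of `indep_sub_of_condExp_indicator`). Starting from
the deterministic initial position and adding times in increasing order, one obtains at once the
Gaussian property, the Markov property, the one-dimensional distributions, the mean and the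
covariance. The variance at `T / 2` differs from that at `T / 4`, so the process is not stationary.

Existence. An isonormal Gaussian process over `L²(ℝ; ℝᵈ)` is built from independent standard
Gaussian variables (`exists_isonormal`); Wiener integrals of multiples of indicator functions of
intervals then give a centred Gaussian process with the covariance of the bridge
(`exists_isCentredBridge`). For such a process the interpolation error at time `r` between the times
`s` and `t` is uncorrelated with, hence independent of, the positions before `s` and after `t`, and
its variance is that of the two-sided transition function; conditioning on the outside positions
therefore yields the Bernstein property and the prescribed transition function
(`IsCentredBridge.isOscillatorBridge`). Only finite-dimensional distributions matter, so no path
regularity is needed, and completing the probability space changes nothing.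
-/

noncomputable section

/-! ### Isotropic Gaussian measures -/

section IsotropicGaussian

variable {d : ℕ}

/-- The density of the Gaussian measure on `ℝᵈ` with mean `m` and covariance `v` times the
identity, for `v > 0`. -/
def gaussDensity (v : ℝ) (m x : EuclideanSpace ℝ (Fin d)) : ℝ :=
  (2 * Real.pi * v) ^ (-(d : ℝ) / 2) * Real.exp (-(‖x - m‖ ^ 2) / (2 * v))

/-- The Gaussian measure on `ℝᵈ` with mean `m` and covariance `v` times the identity. Being an
image of the standard Gaussian measure, it makes sense for `v = 0` too, where it is `δ_m`. -/
def isoGaussian (v : ℝ) (m : EuclideanSpace ℝ (Fin d)) : Measure (EuclideanSpace ℝ (Fin d)) :=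
  (stdGaussian (EuclideanSpace ℝ (Fin d))).map (fun z ↦ m + √v • z)

lemma isoGaussian_eq_map_map (v : ℝ) (m : EuclideanSpace ℝ (Fin d)) :
    isoGaussian v m = ((stdGaussian (EuclideanSpace ℝ (Fin d))).map
      (√v • ContinuousLinearMap.id ℝ (EuclideanSpace ℝ (Fin d)))).map (fun z ↦ m + z) := by
  rw [Measure.map_map (by fun_prop) (by fun_prop)]
  rfl

instance (v : ℝ) (m : EuclideanSpace ℝ (Fin d)) : IsGaussian (isoGaussian v m) := by
  rw [isoGaussian_eq_map_map]
  infer_instance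

lemma isoGaussian_zero_map_add (v : ℝ) (m : EuclideanSpace ℝ (Fin d)) :
    (isoGaussian v 0).map (fun z ↦ m + z) = isoGaussian v m := by
  rw [isoGaussian, isoGaussian, Measure.map_map (by fun_prop) (by fun_prop)]
  congr 1
  ext z : 1
  simp

lemma isoGaussian_zero_left (m : EuclideanSpace ℝ (Fin d)) :
    isoGaussian 0 m = Measure.dirac m := by
  simp [isoGaussian]

lemma charFun_isoGaussian {v : ℝ} (hv : 0 ≤ v) (t : EuclideanSpace ℝ (Fin d)) :
    charFun (isoGaussian v 0) t = Complex.exp (-(v * ‖t‖ ^ 2) / 2) := by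
  have h : isoGaussian v (0 : EuclideanSpace ℝ (Fin d)) =
      (stdGaussian (EuclideanSpace ℝ (Fin d))).map (fun z ↦ √v • z) := by
    simp [isoGaussian]
  have h1 : ‖√v • t‖ ^ 2 = v * ‖t‖ ^ 2 := by
    rw [norm_smul, mul_pow, Real.norm_eq_abs, sq_abs, Real.sq_sqrt hv]
  rw [h, charFun_map_smul, charFun_stdGaussian, ← Complex.ofReal_pow, h1]
  push_cast
  rfl

lemma gaussDensity_pos {v : ℝ} (hv : 0 < v) (m x : EuclideanSpace ℝ (Fin d)) :
    0 < gaussDensity v m x := by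
  unfold gaussDensity
  positivity

lemma continuous_gaussDensity (v : ℝ) (m : EuclideanSpace ℝ (Fin d)) :
    Continuous (gaussDensity v m) := by
  unfold gaussDensity
  fun_prop

/-- The Fourier transform of the Gaussian density. -/
lemma integral_cexp_mul_gaussDensity {v : ℝ} (hv : 0 < v) (t : EuclideanSpace ℝ (Fin d)) :
    ∫ x, (gaussDensity v 0 x : ℂ) * Complex.exp (inner ℝ x t * Complex.I) =
      Complex.exp (-(v * ‖t‖ ^ 2) / 2) := by
  have hb : 0 < ((1 / (2 * v) : ℝ) : ℂ).re := by
    rw [Complex.ofReal_re]; positivity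
  have h := GaussianFourier.integral_cexp_neg_mul_sq_norm_add hb Complex.I t
  have h1 : ∀ x : EuclideanSpace ℝ (Fin d),
      (gaussDensity v 0 x : ℂ) * Complex.exp (inner ℝ x t * Complex.I) =
      (((2 * Real.pi * v) ^ (-(d : ℝ) / 2) : ℝ) : ℂ) *
        Complex.exp (-((1 / (2 * v) : ℝ) : ℂ) * ‖x‖ ^ 2 + Complex.I * inner ℝ t x) := by
    intro x
    rw [gaussDensity, Complex.ofReal_mul, Complex.ofReal_exp, mul_assoc, ← Complex.exp_add,
      real_inner_comm]
    congr 2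
    push_cast
    rw [sub_zero]
    ring
  simp_rw [h1]
  rw [integral_const_mul, h, finrank_euclideanSpace_fin, ← mul_assoc]
  have h2 : (((2 * Real.pi * v) ^ (-(d : ℝ) / 2) : ℝ) : ℂ) *
      ((Real.pi : ℂ) / ((1 / (2 * v) : ℝ) : ℂ)) ^ ((d : ℂ) / 2) = 1 := by
    have : ((Real.pi : ℂ) / ((1 / (2 * v) : ℝ) : ℂ)) ^ ((d : ℂ) / 2) =
        (((2 * Real.pi * v) ^ ((d : ℝ) / 2) : ℝ) : ℂ) := by
      rw [Complex.ofReal_cpow (by positivity)]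
      push_cast
      congr 1
      field_simp
    rw [this, ← Complex.ofReal_mul, ← Real.rpow_add (by positivity)]
    simp [neg_div]
  rw [h2, one_mul]
  congr 1
  have : (v : ℂ) ≠ 0 := by exact_mod_cast hv.ne'
  push_cast
  rw [Complex.I_sq]
  field_simp
  ring

lemma integral_gaussDensity {v : ℝ} (hv : 0 < v) (m : EuclideanSpace ℝ (Fin d)) :
    ∫ x, gaussDensity v m x = 1 := by
  have h := integral_cexp_mul_gaussDensity hv (0 : EuclideanSpace ℝ (Fin d))
  simp only [inner_zero_right, Complex.ofReal_zero, zero_mul, Complex.exp_zero, mul_one,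
    norm_zero, ne_eq, OfNat.ofNat_ne_zero, not_false_eq_true, zero_pow, mul_zero, neg_zero,
    zero_div] at h
  rw [integral_complex_ofReal] at h
  have h' : ∫ x : EuclideanSpace ℝ (Fin d), gaussDensity v 0 x = 1 := by exact_mod_cast h
  rw [← h', ← integral_sub_right_eq_self (gaussDensity v 0) m]
  simp [gaussDensity]

lemma integrable_gaussDensity {v : ℝ} (hv : 0 < v) (m : EuclideanSpace ℝ (Fin d)) :
    Integrable (gaussDensity v m) := by
  by_contra h
  have := integral_gaussDensity hv m
  rw [integral_undef h] at this
  exact zero_ne_one this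

lemma isoGaussian_zero_eq_withDensity {v : ℝ} (hv : 0 < v) :
    isoGaussian v (0 : EuclideanSpace ℝ (Fin d)) =
      volume.withDensity (fun x ↦ ENNReal.ofReal (gaussDensity v 0 x)) := by
  have hfin : IsFiniteMeasure ((volume : Measure (EuclideanSpace ℝ (Fin d))).withDensity
      (fun x ↦ ENNReal.ofReal (gaussDensity v 0 x))) :=
    isFiniteMeasure_withDensity_ofReal (integrable_gaussDensity hv 0).2
  refine Measure.ext_of_charFun ?_
  ext t
  rw [charFun_isoGaussian hv.le, ← integral_cexp_mul_gaussDensity hv, charFun_apply,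
    integral_withDensity_eq_integral_toReal_smul
      (continuous_gaussDensity v 0).measurable.ennreal_ofReal (by simp)]
  refine integral_congr_ae (ae_of_all _ fun x ↦ ?_)
  simp [ENNReal.toReal_ofReal (gaussDensity_pos hv 0 x).le]

lemma isoGaussian_eq_withDensity {v : ℝ} (hv : 0 < v) (m : EuclideanSpace ℝ (Fin d)) :
    isoGaussian v m = volume.withDensity (fun x ↦ ENNReal.ofReal (gaussDensity v m x)) := by
  rw [← isoGaussian_zero_map_add, isoGaussian_zero_eq_withDensity hv]
  ext F hF
  rw [Measure.map_apply (by fun_prop) hF, withDensity_apply _ hF,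
    withDensity_apply _ (hF.preimage (by fun_prop)), ← lintegral_indicator hF,
    ← lintegral_indicator (hF.preimage (by fun_prop))]
  refine Eq.trans (lintegral_congr fun x ↦ ?_) (lintegral_add_left_eq_self _ m)
  by_cases h : m + x ∈ F <;> simp [Set.indicator, h, gaussDensity]

lemma integral_isoGaussian {F : Type*} [NormedAddCommGroup F] [NormedSpace ℝ F]
    {v : ℝ} (hv : 0 < v) (m : EuclideanSpace ℝ (Fin d)) (f : EuclideanSpace ℝ (Fin d) → F) :
    ∫ x, f x ∂(isoGaussian v m) = ∫ x, gaussDensity v m x • f x := by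
  rw [isoGaussian_eq_withDensity hv, integral_withDensity_eq_integral_toReal_smul
      (continuous_gaussDensity v m).measurable.ennreal_ofReal (by simp)]
  simp_rw [ENNReal.toReal_ofReal (gaussDensity_pos hv m _).le]

lemma isoGaussian_real_apply {v : ℝ} (hv : 0 < v) (m : EuclideanSpace ℝ (Fin d))
    {F : Set (EuclideanSpace ℝ (Fin d))} (hF : MeasurableSet F) :
    (isoGaussian v m).real F = ∫ x in F, gaussDensity v m x := by
  rw [isoGaussian_eq_withDensity hv, measureReal_def, withDensity_apply _ hF,
    integral_eq_lintegral_of_nonneg_ae (ae_of_all _ fun x ↦ (gaussDensity_pos hv m x).le)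
      (continuous_gaussDensity v m).aestronglyMeasurable]

lemma integral_id_isoGaussian (v : ℝ) (m : EuclideanSpace ℝ (Fin d)) :
    ∫ x, x ∂(isoGaussian v m) = m := by
  rw [isoGaussian, integral_map (by fun_prop) (by fun_prop), integral_add (integrable_const _),
    integral_smul, integral_id_stdGaussian]
  · simp
  · exact (IsGaussian.integrable_fun_id (μ := stdGaussian (EuclideanSpace ℝ (Fin d)))).smul √v

lemma integral_mul_isoGaussian {v : ℝ} (hv : 0 ≤ v) (i j : Fin d) :
    ∫ x, x i * x j ∂(isoGaussian v (0 : EuclideanSpace ℝ (Fin d))) =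
      v * (if i = j then 1 else 0) := by
  rw [isoGaussian, integral_map (by fun_prop) (by fun_prop)]
  have h : ∫ x, x i * x j ∂(stdGaussian (EuclideanSpace ℝ (Fin d))) =
      if i = j then 1 else 0 := by
    have h1 := covariance_eval_multivariateGaussian
      (μ := (0 : EuclideanSpace ℝ (Fin d))) (S := 1) Matrix.PosSemidef.one i j
    have h0 : ∀ k : Fin d, ∫ x, x k ∂(stdGaussian (EuclideanSpace ℝ (Fin d))) = 0 := fun k ↦
      integral_strongDual_stdGaussian (EuclideanSpace.proj k)
    rw [multivariateGaussian_zero_one] at h1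
    simp only [covariance, h0, sub_zero] at h1
    rw [h1, Matrix.one_apply]
  rw [← h, ← integral_const_mul]
  refine integral_congr_ae (ae_of_all _ fun x ↦ ?_)
  simp only [zero_add, PiLp.smul_apply, smul_eq_mul]
  calc √v * x i * (√v * x j) = (√v * √v) * (x i * x j) := by ring
    _ = _ := by rw [Real.mul_self_sqrt hv]

/-- The covariance is determined by the Gaussian measure. -/
lemma variance_eq_of_isoGaussian_eq [NeZero d] {v w : ℝ} (hv : 0 ≤ v) (hw : 0 ≤ w)
    {m n : EuclideanSpace ℝ (Fin d)} (h : isoGaussian v m = isoGaussian w n) : v = w := by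
  have hm : m = n := by rw [← integral_id_isoGaussian v m, h, integral_id_isoGaussian]
  subst hm
  have h0 : isoGaussian v (0 : EuclideanSpace ℝ (Fin d)) = isoGaussian w 0 := by
    have := congrArg (Measure.map (fun z ↦ -m + z)) h
    rw [← isoGaussian_zero_map_add, ← isoGaussian_zero_map_add w m,
      Measure.map_map (by fun_prop) (by fun_prop),
      Measure.map_map (by fun_prop) (by fun_prop)] at this
    simpa [Function.comp_def] using this
  have h1 := integral_mul_isoGaussian hv (0 : Fin d) 0
  rw [h0, integral_mul_isoGaussian hw] at h1
  simpa using h1.symm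

end IsotropicGaussian

/-! ### Mehler's kernel -/

section Mehler

variable {d : ℕ}

lemma sinh_mul_pos {lam t : ℝ} (hlam : 0 < lam) (ht : 0 < t) : 0 < Real.sinh (lam * t) :=
  Real.sinh_pos_iff.2 (mul_pos hlam ht)

lemma mehlerKernel_pos {lam t : ℝ} (hlam : 0 < lam) (ht : 0 < t)
    (x y : EuclideanSpace ℝ (Fin d)) : 0 < mehlerKernel lam x t y := by
  have := sinh_mul_pos hlam ht
  unfold mehlerKernel
  positivity

lemma mehlerKernel_symm (lam t : ℝ) (x y : EuclideanSpace ℝ (Fin d)) :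
    mehlerKernel lam x t y = mehlerKernel lam y t x := by
  rw [mehlerKernel, mehlerKernel, real_inner_comm, add_comm (‖x‖ ^ 2)]

lemma bridgeVariance_pos {lam T t : ℝ} (hlam : 0 < lam) (ht : 0 < t) (htT : t < T) :
    0 < bridgeVariance lam T t := by
  have h1 := sinh_mul_pos hlam ht
  have h2 := sinh_mul_pos hlam (sub_pos.2 htT)
  have h3 := sinh_mul_pos hlam (ht.trans htT)
  unfold bridgeVariance
  positivity

/-- The product of two Mehler kernels is, as a function of the intermediate point, a multiple of a
Gaussian density: the square is completed in the exponent. -/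
lemma mehlerKernel_mul_mehlerKernel {lam p q : ℝ} (hlam : 0 < lam) (hp : 0 < p) (hq : 0 < q)
    (x y z : EuclideanSpace ℝ (Fin d)) :
    mehlerKernel lam x p z * mehlerKernel lam z q y =
      mehlerKernel lam x (p + q) y * gaussDensity (bridgeVariance lam (p + q) q)
        ((Real.sinh (lam * p) / Real.sinh (lam * (p + q))) • y +
          (Real.sinh (lam * q) / Real.sinh (lam * (p + q))) • x) z := by
  have hS1 := sinh_mul_pos hlam hp
  have hS2 := sinh_mul_pos hlam hq
  have hS := sinh_mul_pos hlam (add_pos hp hq)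
  have hv := bridgeVariance_pos hlam hq (lt_add_of_pos_left q hp)
  have hv_eq : bridgeVariance lam (p + q) q =
      Real.sinh (lam * p) * Real.sinh (lam * q) / (lam * Real.sinh (lam * (p + q))) := by
    rw [bridgeVariance, add_sub_cancel_right]
  have eS : Real.sinh (lam * (p + q)) =
      Real.sinh (lam * p) * Real.cosh (lam * q) + Real.cosh (lam * p) * Real.sinh (lam * q) := by
    rw [mul_add, Real.sinh_add]
  have eC : Real.cosh (lam * (p + q)) =
      Real.cosh (lam * p) * Real.cosh (lam * q) + Real.sinh (lam * p) * Real.sinh (lam * q) := by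
    rw [mul_add, Real.cosh_add]
  have e1 := Real.cosh_sq (lam * p)
  have e2 := Real.cosh_sq (lam * q)
  unfold mehlerKernel gaussDensity
  rw [hv_eq] at hv ⊢
  rw [mul_mul_mul_comm, ← Real.mul_rpow (by positivity) (by positivity), ← Real.exp_add]
  conv_rhs =>
    rw [mul_mul_mul_comm, ← Real.mul_rpow (by positivity) (by positivity), ← Real.exp_add]
  have hnorm (α β : ℝ) : ‖z - (α • y + β • x)‖ ^ 2 = ‖z‖ ^ 2 - 2 * α * inner ℝ z y
      - 2 * β * inner ℝ x z + α ^ 2 * ‖y‖ ^ 2 + β ^ 2 * ‖x‖ ^ 2 + 2 * α * β * inner ℝ x y := by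
    rw [norm_sub_sq_real, norm_add_sq_real, inner_add_right, inner_smul_right, inner_smul_right,
      inner_smul_left, inner_smul_right, norm_smul, norm_smul, mul_pow, mul_pow,
      Real.norm_eq_abs, Real.norm_eq_abs, sq_abs, sq_abs, real_inner_comm z x,
      real_inner_comm y x]
    simp only [conj_trivial]
    ring
  rw [hnorm]
  generalize Real.sinh (lam * (p + q)) = S at *
  generalize Real.cosh (lam * (p + q)) = C at *
  generalize Real.sinh (lam * p) = S1 at *
  generalize Real.sinh (lam * q) = S2 at *
  generalize Real.cosh (lam * p) = C1 at *
  generalize Real.cosh (lam * q) = C2 at *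
  have f1 : C1 = (C * S1 + S2) / S := by
    rw [eq_div_iff hS.ne', eS, eC]; linear_combination S2 * e1
  have f2 : C2 = (C * S2 + S1) / S := by
    rw [eq_div_iff hS.ne', eS, eC]; linear_combination S1 * e2
  have f3 : 2 * C * S1 * S2 = S ^ 2 - S1 ^ 2 - S2 ^ 2 := by
    rw [eS, eC]; linear_combination -S1 ^ 2 * e2 - S2 ^ 2 * e1
  congr 2
  · field_simp
  · rw [f1, f2]
    field_simp
    linear_combination (-‖z‖ ^ 2) * f3

lemma integral_mehlerKernel_mul_mehlerKernel {lam p q : ℝ} (hlam : 0 < lam) (hp : 0 < p)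
    (hq : 0 < q) (x y : EuclideanSpace ℝ (Fin d)) :
    ∫ z, mehlerKernel lam x p z * mehlerKernel lam z q y = mehlerKernel lam x (p + q) y := by
  simp_rw [mehlerKernel_mul_mehlerKernel hlam hp hq x y]
  rw [integral_const_mul, integral_gaussDensity, mul_one]
  exact bridgeVariance_pos hlam hq (lt_add_of_pos_left q hp)

lemma twoSidedTransition_mehlerKernel {lam s r t : ℝ} (hlam : 0 < lam) (hsr : s < r) (hrt : r < t)
    (x y : EuclideanSpace ℝ (Fin d)) {F : Set (EuclideanSpace ℝ (Fin d))} (hF : MeasurableSet F) :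
    twoSidedTransition (mehlerKernel lam) x t F r y s =
      (isoGaussian (bridgeVariance lam (t - s) (r - s))
        ((Real.sinh (lam * (t - r)) / Real.sinh (lam * (t - s))) • y +
          (Real.sinh (lam * (r - s)) / Real.sinh (lam * (t - s))) • x)).real F := by
  have hp := sub_pos.2 hrt
  have hq := sub_pos.2 hsr
  have h1 : t - r + (r - s) = t - s := by ring
  have hv : 0 < bridgeVariance lam (t - s) (r - s) :=
    bridgeVariance_pos hlam hq (by linarith)
  rw [isoGaussian_real_apply hv _ hF, twoSidedTransition]
  refine integral_congr_ae (ae_of_all _ fun z ↦ ?_)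
  have h2 := mehlerKernel_mul_mehlerKernel hlam hp hq x y z
  rw [h1] at h2
  simp only [h2]
  rw [mul_div_cancel_left₀]
  exact (mehlerKernel_pos hlam (by linarith) x y).ne'

/-- Up to a factor, which tends to `1` as `t → 0`, Mehler's kernel is a Gaussian density in its
first variable. -/
lemma mehlerKernel_eq_mul_gaussDensity {lam t : ℝ} (hlam : 0 < lam) (ht : 0 < t)
    (x y : EuclideanSpace ℝ (Fin d)) :
    mehlerKernel lam x t y =
      (Real.cosh (lam * t) ^ (-(d : ℝ) / 2) *
        Real.exp (-(lam * Real.sinh (lam * t) / (2 * Real.cosh (lam * t)) * ‖y‖ ^ 2))) *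
      gaussDensity (Real.sinh (lam * t) / (lam * Real.cosh (lam * t)))
        ((1 / Real.cosh (lam * t)) • y) x := by
  have hS := sinh_mul_pos hlam ht
  have hC := Real.cosh_pos (lam * t)
  have e := Real.cosh_sq (lam * t)
  unfold mehlerKernel gaussDensity
  rw [mul_mul_mul_comm, ← Real.mul_rpow (by positivity) (by positivity), ← Real.exp_add,
    norm_sub_sq_real, inner_smul_right, norm_smul, mul_pow, Real.norm_eq_abs, sq_abs]
  generalize Real.sinh (lam * t) = S at *
  generalize Real.cosh (lam * t) = C at *
  congr 2
  · field_simp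
  · field_simp
    linear_combination (-‖y‖ ^ 2) * e

lemma tendsto_integral_mehlerKernel_mul {lam : ℝ} (hlam : 0 < lam)
    (y : EuclideanSpace ℝ (Fin d))
    (f : BoundedContinuousFunction (EuclideanSpace ℝ (Fin d)) ℝ) :
    Tendsto (fun t ↦ ∫ x, mehlerKernel lam x t y * f x) (𝓝[>] 0) (𝓝 (f y)) := by
  -- In terms of a standard Gaussian vector the integral becomes a mean of values of `f`.
  have key : ∀ t > 0, ∫ x, mehlerKernel lam x t y * f x =
      (Real.cosh (lam * t) ^ (-(d : ℝ) / 2) *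
        Real.exp (-(lam * Real.sinh (lam * t) / (2 * Real.cosh (lam * t)) * ‖y‖ ^ 2))) *
      ∫ z, f ((1 / Real.cosh (lam * t)) • y +
        √(Real.sinh (lam * t) / (lam * Real.cosh (lam * t))) • z)
        ∂(stdGaussian (EuclideanSpace ℝ (Fin d))) := by
    intro t ht
    have hS := sinh_mul_pos hlam ht
    have hv : 0 < Real.sinh (lam * t) / (lam * Real.cosh (lam * t)) := by positivity
    have h := integral_isoGaussian hv ((1 / Real.cosh (lam * t)) • y) f
    rw [isoGaussian, integral_map (by fun_prop) f.continuous.aestronglyMeasurable] at h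
    rw [h, ← integral_const_mul]
    refine integral_congr_ae (ae_of_all _ fun x ↦ ?_)
    simp only [mehlerKernel_eq_mul_gaussDensity hlam ht, smul_eq_mul]
    ring
  have h1 : Tendsto (fun t ↦ Real.cosh (lam * t) ^ (-(d : ℝ) / 2) *
        Real.exp (-(lam * Real.sinh (lam * t) / (2 * Real.cosh (lam * t)) * ‖y‖ ^ 2)))
      (𝓝[>] 0) (𝓝 1) := by
    have hc : Continuous (fun t ↦ Real.cosh (lam * t) ^ (-(d : ℝ) / 2) *
        Real.exp (-(lam * Real.sinh (lam * t) / (2 * Real.cosh (lam * t)) * ‖y‖ ^ 2))) := by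
      refine Continuous.mul ?_ ?_
      · exact Continuous.rpow_const (by fun_prop) fun t ↦ Or.inl (Real.cosh_pos _).ne'
      · refine Real.continuous_exp.comp (Continuous.neg (Continuous.mul ?_ continuous_const))
        exact Continuous.div (by fun_prop) (by fun_prop)
          fun t ↦ (mul_pos two_pos (Real.cosh_pos _)).ne'
    have := hc.tendsto 0
    simp only [mul_zero, Real.cosh_zero, Real.one_rpow, Real.sinh_zero, zero_div, zero_mul,
      neg_zero, Real.exp_zero, mul_one] at this
    exact this.mono_left nhdsWithin_le_nhds
  have h2 : Tendsto (fun t ↦ ∫ z, f ((1 / Real.cosh (lam * t)) • y +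
        √(Real.sinh (lam * t) / (lam * Real.cosh (lam * t))) • z)
        ∂(stdGaussian (EuclideanSpace ℝ (Fin d)))) (𝓝[>] 0) (𝓝 (f y)) := by
    have h3 : f y = ∫ z, f y ∂(stdGaussian (EuclideanSpace ℝ (Fin d))) := by simp
    rw [h3]
    refine tendsto_integral_filter_of_dominated_convergence (fun _ ↦ ‖f‖) ?_ ?_
      (integrable_const _) ?_
    · refine Eventually.of_forall fun t ↦ Continuous.aestronglyMeasurable ?_
      exact f.continuous.comp (by fun_prop)
    · exact Eventually.of_forall fun t ↦ ae_of_all _ fun z ↦ f.norm_coe_le_norm _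
    · refine ae_of_all _ fun z ↦ ?_
      have hc1 : Continuous (fun t ↦ 1 / Real.cosh (lam * t)) :=
        Continuous.div (by fun_prop) (by fun_prop) fun t ↦ (Real.cosh_pos _).ne'
      have hc2 : Continuous (fun t ↦ √(Real.sinh (lam * t) / (lam * Real.cosh (lam * t)))) :=
        Real.continuous_sqrt.comp (Continuous.div (by fun_prop) (by fun_prop)
          fun t ↦ (mul_pos hlam (Real.cosh_pos _)).ne')
      have hc : Continuous (fun t ↦ f ((1 / Real.cosh (lam * t)) • y +
          √(Real.sinh (lam * t) / (lam * Real.cosh (lam * t))) • z)) :=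
        f.continuous.comp ((hc1.smul continuous_const).add (hc2.smul continuous_const))
      have := hc.tendsto 0
      simp only [mul_zero, Real.cosh_zero, Real.sinh_zero, zero_div, Real.sqrt_zero, zero_smul,
        add_zero, div_one, one_smul] at this
      exact this.mono_left nhdsWithin_le_nhds
  have h4 := h1.mul h2
  rw [one_mul] at h4
  refine h4.congr' ?_
  filter_upwards [self_mem_nhdsWithin] with t ht
  exact (key t ht).symm

/-- The Laplacian of the exponential of an isotropic quadratic polynomial. -/
lemma laplacian_exp_quadratic (a c : ℝ) (w x : EuclideanSpace ℝ (Fin d)) :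
    Laplacian.laplacian (fun x' : EuclideanSpace ℝ (Fin d) ↦
        Real.exp (-a * ‖x'‖ ^ 2 + inner ℝ w x' + c)) x =
      (‖w - (2 * a) • x‖ ^ 2 - 2 * a * d) * Real.exp (-a * ‖x‖ ^ 2 + inner ℝ w x + c) := by
  set f : EuclideanSpace ℝ (Fin d) → ℝ := fun x' ↦
    Real.exp (-a * ‖x'‖ ^ 2 + inner ℝ w x' + c) with hf
  let B : EuclideanSpace ℝ (Fin d) →L[ℝ] EuclideanSpace ℝ (Fin d) →L[ℝ] ℝ :=
    (isBoundedBilinearMap_inner (𝕜 := ℝ)).toContinuousLinearMap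
  have hB : ∀ u v, B u v = inner ℝ u v := fun u v ↦ rfl
  let L : EuclideanSpace ℝ (Fin d) → EuclideanSpace ℝ (Fin d) →L[ℝ] ℝ :=
    fun x' ↦ B (w - (2 * a) • x')
  have hd1 : ∀ x', HasFDerivAt f (f x' • L x') x' := by
    intro x'
    have h1 : HasFDerivAt (fun u : EuclideanSpace ℝ (Fin d) ↦ ‖u‖ ^ 2) (2 • innerSL ℝ x') x' :=
      (hasStrictFDerivAt_norm_sq x').hasFDerivAt
    have h2 : HasFDerivAt (fun u : EuclideanSpace ℝ (Fin d) ↦ inner ℝ w u) (innerSL ℝ w) x' :=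
      (innerSL ℝ w).hasFDerivAt
    have h3 := (((h1.const_mul (-a)).add h2).add_const c).exp
    refine h3.congr_fderiv ?_
    ext u
    simp [L, f, hB]
    ring
  have hfd : fderiv ℝ f = fun x' ↦ f x' • L x' := funext fun x' ↦ (hd1 x').fderiv
  have hL : HasFDerivAt L (-(2 * a) • B) x := by
    have h1 : HasFDerivAt (fun x' : EuclideanSpace ℝ (Fin d) ↦ w - (2 * a) • x')
        (-((2 * a) • ContinuousLinearMap.id ℝ (EuclideanSpace ℝ (Fin d)))) x :=
      ((hasFDerivAt_id (𝕜 := ℝ) x).const_smul (2 * a)).const_sub w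
    refine (B.hasFDerivAt.comp x h1).congr_fderiv ?_
    ext u v
    simp
  have hd2 : fderiv ℝ (fun x' ↦ f x' • L x') x = _ := ((hd1 x).smul hL).fderiv
  rw [InnerProductSpace.laplacian_eq_iteratedFDeriv_orthonormalBasis f
    (EuclideanSpace.basisFun (Fin d) ℝ)]
  simp only [iteratedFDeriv_two_apply, hfd, hd2, Matrix.cons_val_zero, Matrix.cons_val_one]
  have hsum : ∀ i : Fin d, ((f x • (-(2 * a) • B) + (f x • L x).smulRight (L x))
      (EuclideanSpace.basisFun (Fin d) ℝ i)) (EuclideanSpace.basisFun (Fin d) ℝ i) =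
      (inner ℝ (EuclideanSpace.basisFun (Fin d) ℝ i) (w - (2 * a) • x) ^ 2 - 2 * a) * f x := by
    intro i
    have h1 : inner ℝ (EuclideanSpace.basisFun (Fin d) ℝ i)
        (EuclideanSpace.basisFun (Fin d) ℝ i) = (1 : ℝ) := by simp
    have h2 : L x (EuclideanSpace.basisFun (Fin d) ℝ i) =
      inner ℝ (EuclideanSpace.basisFun (Fin d) ℝ i) (w - (2 * a) • x) := by
      rw [real_inner_comm]; rfl
    simp only [add_apply, smul_apply, ContinuousLinearMap.smulRight_apply, smul_eq_mul, h2, hB, h1]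
    ring
  rw [Finset.sum_congr rfl fun i _ ↦ hsum i, ← Finset.sum_mul, Finset.sum_sub_distrib,
    OrthonormalBasis.sum_sq_inner_right]
  simp only [Finset.sum_const, Finset.card_univ, Fintype.card_fin, nsmul_eq_mul, hf]
  ring

lemma contDiff_exp_quadratic (a c : ℝ) (w : EuclideanSpace ℝ (Fin d)) :
    ContDiff ℝ 2 (fun x : EuclideanSpace ℝ (Fin d) ↦
      Real.exp (-a * ‖x‖ ^ 2 + inner ℝ w x + c)) :=
  (((contDiff_const.mul (contDiff_norm_sq ℝ)).add (contDiff_const.inner ℝ contDiff_id)).add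
    contDiff_const).exp

lemma mehlerKernel_eq_exp_quadratic {lam t : ℝ} (y x : EuclideanSpace ℝ (Fin d))
    (hS : Real.sinh (lam * t) ≠ 0) :
    mehlerKernel lam x t y = (2 * Real.pi * Real.sinh (lam * t) / lam) ^ (-(d : ℝ) / 2) *
      Real.exp (-(lam * Real.cosh (lam * t) / (2 * Real.sinh (lam * t))) * ‖x‖ ^ 2 +
        inner ℝ ((lam / Real.sinh (lam * t)) • y) x +
        (-(lam * Real.cosh (lam * t) * ‖y‖ ^ 2 / (2 * Real.sinh (lam * t))))) := by
  rw [mehlerKernel, inner_smul_left, real_inner_comm]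
  congr 2
  simp only [conj_trivial]
  field_simp
  ring

lemma contDiff_mehlerKernel {lam t : ℝ} (hlam : 0 < lam) (ht : 0 < t)
    (y : EuclideanSpace ℝ (Fin d)) : ContDiff ℝ 2 (fun x ↦ mehlerKernel lam x t y) := by
  simp_rw [fun x ↦ mehlerKernel_eq_exp_quadratic y x (sinh_mul_pos hlam ht).ne']
  exact contDiff_const.mul (contDiff_exp_quadratic _ _ _)

lemma hasDerivAt_mehlerKernel {lam t : ℝ} (hlam : 0 < lam) (ht : 0 < t)
    (x y : EuclideanSpace ℝ (Fin d)) :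
    HasDerivAt (fun t' ↦ mehlerKernel lam x t' y)
      ((1 / 2) * Laplacian.laplacian (fun x' ↦ mehlerKernel lam x' t y) x -
        oscillatorPotential lam x * mehlerKernel lam x t y) t := by
  have hS := sinh_mul_pos hlam ht
  have hC := Real.cosh_pos (lam * t)
  have hlap : Laplacian.laplacian (fun x' ↦ mehlerKernel lam x' t y) x =
      (‖(lam / Real.sinh (lam * t)) • y -
        (2 * (lam * Real.cosh (lam * t) / (2 * Real.sinh (lam * t)))) • x‖ ^ 2 -
        2 * (lam * Real.cosh (lam * t) / (2 * Real.sinh (lam * t))) * d) *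
        mehlerKernel lam x t y := by
    have h1 : (fun x' ↦ mehlerKernel lam x' t y) =
        ((2 * Real.pi * Real.sinh (lam * t) / lam) ^ (-(d : ℝ) / 2)) •
        (fun x' : EuclideanSpace ℝ (Fin d) ↦
          Real.exp (-(lam * Real.cosh (lam * t) / (2 * Real.sinh (lam * t))) * ‖x'‖ ^ 2 +
          inner ℝ ((lam / Real.sinh (lam * t)) • y) x' +
          (-(lam * Real.cosh (lam * t) * ‖y‖ ^ 2 / (2 * Real.sinh (lam * t)))))) := by
      ext x'
      rw [mehlerKernel_eq_exp_quadratic y x' hS.ne']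
      rfl
    rw [h1, InnerProductSpace.laplacian_smul, laplacian_exp_quadratic,
      mehlerKernel_eq_exp_quadratic y x hS.ne', smul_eq_mul]
    · ring
    · exact (contDiff_exp_quadratic _ _ _).contDiffAt
  have hl : HasDerivAt (fun t' ↦ lam * t') lam t := by
    simpa using (hasDerivAt_id t).const_mul lam
  have hsinh : HasDerivAt (fun t' ↦ Real.sinh (lam * t')) (Real.cosh (lam * t) * lam) t := hl.sinh
  have hcosh : HasDerivAt (fun t' ↦ Real.cosh (lam * t')) (Real.sinh (lam * t) * lam) t := hl.cosh
  have hpow := ((hsinh.const_mul (2 * Real.pi)).div_const lam).rpow_const (p := -(d : ℝ) / 2)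
    (Or.inl (by positivity))
  have e := Real.cosh_sq (lam * t)
  have hquot : HasDerivAt (fun t' ↦ -(lam * (Real.cosh (lam * t') * (‖x‖ ^ 2 + ‖y‖ ^ 2) -
      2 * inner ℝ x y)) / (2 * Real.sinh (lam * t')))
      (lam ^ 2 / (2 * Real.sinh (lam * t) ^ 2) *
        (‖x‖ ^ 2 + ‖y‖ ^ 2 - 2 * Real.cosh (lam * t) * inner ℝ x y)) t := by
    refine ((((hcosh.mul_const (‖x‖ ^ 2 + ‖y‖ ^ 2)).sub_const (2 * inner ℝ x y)).const_mul
      lam).neg.div (hsinh.const_mul 2) (by positivity)).congr_deriv ?_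
    simp only [Pi.neg_apply]
    field_simp
    linear_combination (‖x‖ ^ 2 + ‖y‖ ^ 2) * e
  refine (hpow.mul hquot.exp).congr_deriv ?_
  rw [hlap, oscillatorPotential, Real.rpow_sub_one (by positivity), norm_sub_sq_real,
    inner_smul_left, inner_smul_right, real_inner_comm x y]
  simp only [conj_trivial, mehlerKernel, norm_smul, mul_pow, Real.norm_eq_abs, sq_abs]
  generalize Real.sinh (lam * t) = S at *
  generalize Real.cosh (lam * t) = C at *
  generalize (2 * Real.pi * S / lam) ^ (-(d : ℝ) / 2) = A
  generalize Real.exp (-(lam * (C * (‖x‖ ^ 2 + ‖y‖ ^ 2) - 2 * inner ℝ x y)) / (2 * S)) = D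
  have hpi := Real.pi_pos
  field_simp
  linear_combination (-lam * ‖x‖ ^ 2 * A * D) * e

theorem isGreenFunction_mehlerKernel (T : ℝ) {lam : ℝ} (hlam : 0 < lam) :
    IsGreenFunction (d := d) (oscillatorPotential lam) T (mehlerKernel lam) where
  pos _ ht := mehlerKernel_pos hlam ht.1
  symm t _ := mehlerKernel_symm lam t
  contDiff _ ht := contDiff_mehlerKernel hlam ht.1
  equation _ ht x y := (hasDerivAt_mehlerKernel hlam ht.1 x y).hasDerivWithinAt
  composition _ hs _ ht _ := integral_mehlerKernel_mul_mehlerKernel hlam hs ht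
  initial := tendsto_integral_mehlerKernel_mul hlam

end Mehler

/-! ### Conditioning and independence -/

section Conditioning

variable {Ω : Type*} {m mΩ : MeasurableSpace Ω} {P : Measure Ω}

lemma condExp_ofReal {f : Ω → ℝ} (hf : Integrable f P) :
    P[fun ω ↦ (f ω : ℂ) | m] =ᵐ[P] fun ω ↦ ((P[f | m]) ω : ℂ) :=
  (Complex.ofRealCLM.comp_condExp_comm hf).symm

variable [IsProbabilityMeasure P] {E : Type*} [NormedAddCommGroup E] [MeasurableSpace E]
  [BorelSpace E] [SecondCountableTopology E]

/-- If `X` is measurable with respect to a sigma-algebra and `ε` is independent of it, then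
conditionally on the sigma-algebra the law of `X + ε` is that of `ε`, translated by `X`. -/
lemma condExp_comp_add_of_indep {F : Type*} [NormedAddCommGroup F] [NormedSpace ℝ F]
    [CompleteSpace F] (hm : m ≤ mΩ) {X ε : Ω → E} (hX : Measurable[m] X)
    (hε : Measurable ε) (hind : Indep m (MeasurableSpace.comap ε inferInstance) P)
    {f : E → F} (hf : StronglyMeasurable f) {C : ℝ} (hC : ∀ x, ‖f x‖ ≤ C) :
    P[fun ω ↦ f (X ω + ε ω) | m] =ᵐ[P] fun ω ↦ ∫ z, f (X ω + z) ∂(P.map ε) := by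
  have hXm : Measurable X := hX.mono hm le_rfl
  have : IsProbabilityMeasure (P.map ε) := Measure.isProbabilityMeasure_map hε.aemeasurable
  have hg : StronglyMeasurable (fun x ↦ ∫ z, f (x + z) ∂(P.map ε)) :=
    StronglyMeasurable.integral_prod_right' (f := fun p : E × E ↦ f (p.1 + p.2))
      (hf.comp_measurable (by fun_prop))
  have hgC : ∀ x, ‖∫ z, f (x + z) ∂(P.map ε)‖ ≤ C := by
    intro x
    refine (norm_integral_le_of_norm_le_const (ae_of_all _ fun z ↦ hC (x + z))).trans ?_
    simp
  have hfi : Integrable (fun ω ↦ f (X ω + ε ω)) P :=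
    Integrable.of_bound (hf.comp_measurable (hXm.add hε)).aestronglyMeasurable C
      (ae_of_all _ fun ω ↦ hC _)
  have hgi : Integrable (fun ω ↦ ∫ z, f (X ω + z) ∂(P.map ε)) P :=
    Integrable.of_bound (hg.comp_measurable hXm).aestronglyMeasurable C
      (ae_of_all _ fun ω ↦ hgC _)
  refine (ae_eq_condExp_of_forall_setIntegral_eq hm hfi (fun _ _ _ ↦ hgi.integrableOn) ?_
    (hg.comp_measurable hX).aestronglyMeasurable).symm
  intro G hG _
  have hGm : MeasurableSet G := hm _ hG
  -- The event is encoded, together with `X`, in a random vector independent of `ε`.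
  let Y : Ω → E × ℝ := fun ω ↦ (X ω, G.indicator (fun _ ↦ (1 : ℝ)) ω)
  have hY : Measurable[m] Y := hX.prodMk (measurable_const.indicator hG)
  have hYm : Measurable Y := hY.mono hm le_rfl
  have hYε : IndepFun Y ε P := (IndepFun_iff_Indep _ _ _).2
    (indep_of_indep_of_le_left hind hY.comap_le)
  have hlaw := (indepFun_iff_map_prod_eq_prod_map_map hYm.aemeasurable hε.aemeasurable).1 hYε
  have : IsProbabilityMeasure (P.map Y) := Measure.isProbabilityMeasure_map hYm.aemeasurable
  have hh : StronglyMeasurable (fun p : (E × ℝ) × E ↦ p.1.2 • f (p.1.1 + p.2)) :=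
    (measurable_snd.comp measurable_fst).stronglyMeasurable.smul
      (hf.comp_measurable (by fun_prop))
  have hint : Integrable (fun p : (E × ℝ) × E ↦ p.1.2 • f (p.1.1 + p.2))
      ((P.map Y).prod (P.map ε)) := by
    rw [← hlaw, integrable_map_measure hh.aestronglyMeasurable (by fun_prop)]
    refine (hfi.indicator hGm).congr (ae_of_all _ fun ω ↦ ?_)
    by_cases h : ω ∈ G <;> simp [Y, h]
  calc ∫ ω in G, ∫ z, f (X ω + z) ∂(P.map ε) ∂P
      = ∫ ω, ∫ z, (Y ω).2 • f ((Y ω).1 + z) ∂(P.map ε) ∂P := by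
        rw [← integral_indicator hGm]
        refine integral_congr_ae (ae_of_all _ fun ω ↦ ?_)
        by_cases h : ω ∈ G <;> simp [Y, h]
    _ = ∫ y, ∫ z, y.2 • f (y.1 + z) ∂(P.map ε) ∂(P.map Y) := by
        rw [integral_map hYm.aemeasurable]
        exact (StronglyMeasurable.integral_prod_right' hh).aestronglyMeasurable
    _ = ∫ p, p.1.2 • f (p.1.1 + p.2) ∂((P.map Y).prod (P.map ε)) := (integral_prod _ hint).symm
    _ = ∫ ω, (Y ω).2 • f ((Y ω).1 + ε ω) ∂P := by
        rw [← hlaw, integral_map (by fun_prop) hh.aestronglyMeasurable]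
    _ = ∫ ω in G, f (X ω + ε ω) ∂P := by
        rw [← integral_indicator hGm]
        refine integral_congr_ae (ae_of_all _ fun ω ↦ ?_)
        by_cases h : ω ∈ G <;> simp [Y, h]

/-- Converse of `condExp_comp_add_of_indep`: if conditionally on a sigma-algebra the law of `Z` is a
fixed law, translated by a vector `X` measurable with respect to the sigma-algebra, then
`Z - X` has that law and is independent of the sigma-algebra. -/
lemma indep_sub_of_condExp_indicator (hm : m ≤ mΩ) {X Z : Ω → E}
    (hX : Measurable[m] X) (hZ : Measurable Z) (ν : Measure E) [IsProbabilityMeasure ν]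
    (h : ∀ F : Set E, MeasurableSet F →
      P⟦Z ⁻¹' F | m⟧ =ᵐ[P] fun ω ↦ (ν.map (fun z ↦ X ω + z)).real F) :
    Indep m (MeasurableSpace.comap (fun ω ↦ Z ω - X ω) inferInstance) P ∧
      P.map (fun ω ↦ Z ω - X ω) = ν := by
  have hXm : Measurable X := hX.mono hm le_rfl
  have key : ∀ G, MeasurableSet[m] G → ∀ F, MeasurableSet F →
      P (G ∩ (fun ω ↦ Z ω - X ω) ⁻¹' F) = P G * ν F := by
    intro G hG F hF
    have hGm : MeasurableSet G := hm _ hG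
    -- The event is encoded, together with `X`, in a random vector.
    let Y : Ω → E × ℝ := fun ω ↦ (X ω, G.indicator (fun _ ↦ (1 : ℝ)) ω)
    have hY : Measurable[m] Y := hX.prodMk (measurable_const.indicator hG)
    have hYm : Measurable Y := hY.mono hm le_rfl
    have : IsProbabilityMeasure (P.map Y) := Measure.isProbabilityMeasure_map hYm.aemeasurable
    -- The joint law of `Y` and `Z` is tested on products `A × B`, on which it is the integral over
    -- `Y ∈ A` of the conditional probability of `Z ∈ B`.
    have hlaw : P.map (fun ω ↦ (Y ω, Z ω)) =
        ((P.map Y).prod ν).map (fun p ↦ (p.1, p.1.1 + p.2)) := by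
      have : IsProbabilityMeasure (P.map (fun ω ↦ (Y ω, Z ω))) :=
        Measure.isProbabilityMeasure_map (by fun_prop)
      refine Measure.ext_prod fun {A} {B} hA hB ↦ ?_
      have hmeas : Measurable (fun x : E ↦ ν ((fun z ↦ x + z) ⁻¹' B)) :=
        measurable_measure_prodMk_left (s := (fun p : E × E ↦ p.1 + p.2) ⁻¹' B)
          (hB.preimage (by fun_prop))
      have hr : ∀ ω, (ν.map (fun z ↦ X ω + z)).real B = (ν ((fun z ↦ X ω + z) ⁻¹' B)).toReal := by
        intro ω
        rw [measureReal_def, Measure.map_apply (by fun_prop) hB]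
      have h1 : P (Y ⁻¹' A ∩ Z ⁻¹' B) = ∫⁻ ω in Y ⁻¹' A, ν ((fun z ↦ X ω + z) ⁻¹' B) ∂P := by
        have h2 : (P (Y ⁻¹' A ∩ Z ⁻¹' B)).toReal =
            ∫ ω in Y ⁻¹' A, (ν ((fun z ↦ X ω + z) ⁻¹' B)).toReal ∂P := by
          have h3 := setIntegral_condExp (μ := P) hm
            (f := (Z ⁻¹' B).indicator (fun _ ↦ (1 : ℝ)))
            ((integrable_const 1).indicator (hZ hB)) (hY hA)
          rw [setIntegral_congr_ae (hYm hA) ((h B hB).mono fun ω h _ ↦ h)] at h3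
          simp_rw [hr] at h3
          rw [h3, setIntegral_indicator (hZ hB)]
          simp [measureReal_def]
        have hmX : Measurable (fun ω ↦ ν ((fun z ↦ X ω + z) ⁻¹' B)) := hmeas.comp hXm
        rw [integral_toReal hmX.aemeasurable
          (ae_of_all _ fun ω ↦ measure_lt_top _ _)] at h2
        refine (ENNReal.toReal_eq_toReal_iff' (measure_ne_top _ _) ?_).1 h2
        refine ((lintegral_mono fun ω ↦ prob_le_one).trans_lt ?_).ne
        simp
      rw [Measure.map_apply (by fun_prop) (hA.prod hB),
        Measure.map_apply (by fun_prop) (hA.prod hB)]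
      have h4 : (fun ω ↦ (Y ω, Z ω)) ⁻¹' A ×ˢ B = Y ⁻¹' A ∩ Z ⁻¹' B := rfl
      rw [h4, h1, Measure.prod_apply (by measurability),
        lintegral_map (measurable_measure_prodMk_left (by measurability)) hYm,
        ← lintegral_indicator (hYm hA)]
      refine lintegral_congr fun ω ↦ ?_
      by_cases hω : ω ∈ Y ⁻¹' A
      · rw [Set.indicator_of_mem hω]
        congr 1
        ext z
        have hω' : Y ω ∈ A := hω
        simp [hω', Y]
      · rw [Set.indicator_of_notMem hω]
        symm
        convert measure_empty (μ := ν)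
        ext z
        have hω' : Y ω ∉ A := hω
        simp [hω']
    -- Shearing back makes the law of `(Y, Z - X)` a product, to be tested on `{1} × F`.
    have hlaw' := congrArg (Measure.map (fun p : (E × ℝ) × E ↦ (p.1, p.2 - p.1.1))) hlaw
    rw [Measure.map_map (by fun_prop) (by fun_prop),
      Measure.map_map (by fun_prop) (by fun_prop)] at hlaw'
    have h5 : ((fun p : (E × ℝ) × E ↦ (p.1, p.2 - p.1.1)) ∘ fun p ↦ (p.1, p.1.1 + p.2)) = id := by
      ext p : 1
      simp
    rw [h5, Measure.map_id] at hlaw'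
    have h6 := congrArg (fun μ ↦ μ ((Prod.snd ⁻¹' {(1 : ℝ)}) ×ˢ F)) hlaw'
    simp only [Measure.prod_prod] at h6
    have h7 : Y ⁻¹' (Prod.snd ⁻¹' {(1 : ℝ)}) = G := by
      ext ω
      by_cases hω : ω ∈ G <;> simp [Y, hω]
    rw [Measure.map_apply (by fun_prop)
      ((measurable_snd (measurableSet_singleton 1)).prod hF),
      Measure.map_apply hYm (measurable_snd (measurableSet_singleton 1)), h7] at h6
    rw [← h6]
    congr 1
    ext ω
    by_cases hω : ω ∈ G <;> simp [Y, hω]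
  have hlaw : P.map (fun ω ↦ Z ω - X ω) = ν := by
    ext F hF
    rw [Measure.map_apply (by fun_prop) hF]
    simpa using key Set.univ MeasurableSet.univ F hF
  refine ⟨?_, hlaw⟩
  rw [Indep_iff]
  rintro G _ hG ⟨F, hF, rfl⟩
  rw [key G hG F hF, ← hlaw, Measure.map_apply (by fun_prop) hF]

end Conditioning

/-! ### The Bernstein bridge: conditional laws -/

section BridgeLaws

variable {d : ℕ} {T lam : ℝ}

/-- The normalization makes the endpoint measure a probability measure. -/
lemma bridgeNormalization_sq_mul_mehlerKernel (hlam : 0 < lam) (hT : 0 < T)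
    (b : EuclideanSpace ℝ (Fin d)) :
    bridgeNormalization lam T b * bridgeNormalization lam T b * mehlerKernel lam 0 T b = 1 := by
  have hS := sinh_mul_pos hlam hT
  have h0 : 0 < 2 * Real.pi * Real.sinh (lam * T) / lam := by positivity
  unfold bridgeNormalization mehlerKernel
  have h1 : ∀ u v w z : ℝ, u * v * (u * v) * (w * z) = (u * u * w) * (v * v * z) := by
    intros; ring
  have h2 : (d : ℝ) / 4 + d / 4 + -d / 2 = 0 := by ring
  rw [h1, ← Real.rpow_add h0, ← Real.rpow_add h0, ← Real.exp_add, ← Real.exp_add, h2,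
    Real.rpow_zero, one_mul, ← Real.exp_zero]
  congr 1
  simp only [norm_zero, inner_zero_left]
  field_simp
  ring

lemma endpointMeasure_bridge (hlam : 0 < lam) (hT : 0 < T) (b : EuclideanSpace ℝ (Fin d)) :
    endpointMeasure (mehlerKernel lam) T (bridgeInitialDatum lam T b) (bridgeFinalDatum lam T b) =
      Measure.dirac (0, b) := by
  have hS := sinh_mul_pos hlam hT
  have hN : 0 ≤ bridgeNormalization lam T b := by
    unfold bridgeNormalization
    positivity
  rw [endpointMeasure, bridgeInitialDatum, bridgeFinalDatum, Measure.prod_smul_left,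
    Measure.prod_smul_right, Measure.dirac_prod_dirac, withDensity_smul_measure,
    withDensity_smul_measure, dirac_withDensity, smul_smul, smul_smul, ← ENNReal.ofReal_mul hN,
    ← ENNReal.ofReal_mul (mul_nonneg hN hN), bridgeNormalization_sq_mul_mehlerKernel hlam hT,
    ENNReal.ofReal_one, one_smul]

/-- The identity behind the linear interpolation of the bridge: as functions of `r`, both sides
solve `u'' = u` and agree at `r = p` and `r = q`. -/
lemma sinh_sub_mul_sinh_add (p q r : ℝ) :
    Real.sinh (q - r) * Real.sinh p + Real.sinh (r - p) * Real.sinh q =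
      Real.sinh (q - p) * Real.sinh r := by
  have e1 := Real.cosh_sq p
  have e2 := Real.cosh_sq q
  have e3 := Real.cosh_sq r
  simp only [Real.sinh_sub]
  ring

lemma bridgeMean_interpolation (hlam : 0 < lam) (b : EuclideanSpace ℝ (Fin d)) {s r t : ℝ}
    (hst : s < t) :
    bridgeMean lam T b r =
      (Real.sinh (lam * (t - r)) / Real.sinh (lam * (t - s))) • bridgeMean lam T b s +
        (Real.sinh (lam * (r - s)) / Real.sinh (lam * (t - s))) • bridgeMean lam T b t := by
  have h := sinh_sub_mul_sinh_add (lam * s) (lam * t) (lam * r)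
  have hS := sinh_mul_pos hlam (sub_pos.2 hst)
  simp only [← mul_sub] at h
  simp only [bridgeMean, smul_smul, ← add_smul]
  congr 1
  field_simp
  linear_combination (-(Real.sinh (lam * T))⁻¹) * h

lemma bridgeMean_zero (b : EuclideanSpace ℝ (Fin d)) : bridgeMean lam T b 0 = 0 := by
  simp [bridgeMean]

lemma bridgeMean_self (hlam : 0 < lam) (hT : 0 < T) (b : EuclideanSpace ℝ (Fin d)) :
    bridgeMean lam T b T = b := by
  rw [bridgeMean, div_self (sinh_mul_pos hlam hT).ne', one_smul]

lemma bridgeVariance_nonneg (hlam : 0 < lam) {t : ℝ} (ht : 0 ≤ t) (htT : t ≤ T) :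
    0 ≤ bridgeVariance lam T t := by
  have h1 := Real.sinh_nonneg_iff.2 (mul_nonneg hlam.le ht)
  have h2 := Real.sinh_nonneg_iff.2 (mul_nonneg hlam.le (sub_nonneg.2 htT))
  have h3 := Real.sinh_nonneg_iff.2 (mul_nonneg hlam.le (ht.trans htT))
  unfold bridgeVariance
  positivity

variable {Ω : Type*} {Z : Set.Icc (0 : ℝ) T → Ω → EuclideanSpace ℝ (Fin d)}

lemma presentField_le_pastField {s τ : Set.Icc (0 : ℝ) T} (h : τ ≤ s) :
    presentField Z τ ≤ pastField Z s :=
  le_iSup₂_of_le τ h le_rfl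

lemma presentField_le_futureField {s τ : Set.Icc (0 : ℝ) T} (h : s ≤ τ) :
    presentField Z τ ≤ futureField Z s :=
  le_iSup₂_of_le τ h le_rfl

lemma measurable_presentField (s : Set.Icc (0 : ℝ) T) : Measurable[presentField Z s] (Z s) :=
  comap_measurable _

lemma measurable_pastField_restrict {s : Set.Icc (0 : ℝ) T} {I : Finset (Set.Icc (0 : ℝ) T)}
    (hI : ∀ i ∈ I, i ≤ s) (c : Set.Icc (0 : ℝ) T → EuclideanSpace ℝ (Fin d)) :
    Measurable[pastField Z s] (fun ω ↦ I.restrict fun t ↦ Z t ω - c t) := by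
  let m : MeasurableSpace Ω := pastField Z s
  refine measurable_pi_lambda _ fun i ↦ ?_
  exact ((measurable_presentField i.1).mono
    (presentField_le_pastField (hI _ i.2)) le_rfl).sub_const _

variable {mΩ : MeasurableSpace Ω} {P : Measure Ω} {b : EuclideanSpace ℝ (Fin d)}

lemma pastField_le (hZ : ∀ t, Measurable (Z t)) (s : Set.Icc (0 : ℝ) T) : pastField Z s ≤ mΩ :=
  iSup₂_le fun τ _ ↦ (hZ τ).comap_le

lemma futureField_le (hZ : ∀ t, Measurable (Z t)) (s : Set.Icc (0 : ℝ) T) :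
    futureField Z s ≤ mΩ :=
  iSup₂_le fun τ _ ↦ (hZ τ).comap_le

lemma presentField_le (hZ : ∀ t, Measurable (Z t)) (s : Set.Icc (0 : ℝ) T) :
    presentField Z s ≤ mΩ :=
  (hZ s).comap_le

lemma IsOscillatorBridge.ae_start_and_end (hlam : 0 < lam) {hT : 0 < T}
    (hZ : IsOscillatorBridge hT lam b Z P) :
    (∀ᵐ ω ∂P, Z ⟨0, Set.left_mem_Icc.2 hT.le⟩ ω = 0) ∧
      ∀ᵐ ω ∂P, Z ⟨T, Set.right_mem_Icc.2 hT.le⟩ ω = b := by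
  have h1 := hZ.endpoints
  rw [endpointMeasure_bridge hlam hT] at h1
  have h2 : HasLaw (fun ω ↦ (Z ⟨0, Set.left_mem_Icc.2 hT.le⟩ ω,
      Z ⟨T, Set.right_mem_Icc.2 hT.le⟩ ω)) (Measure.dirac ((0 : EuclideanSpace ℝ (Fin d)), b)) P :=
    ⟨((hZ.measurable _).prodMk (hZ.measurable _)).aemeasurable, h1⟩
  have h3 := h2.ae_eq_of_dirac
  exact ⟨h3.mono fun ω h ↦ congrArg Prod.fst h, h3.mono fun ω h ↦ congrArg Prod.snd h⟩

lemma isoGaussian_real_eq_map (v : ℝ) (m : EuclideanSpace ℝ (Fin d))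
    (F : Set (EuclideanSpace ℝ (Fin d))) :
    (isoGaussian v m).real F = ((isoGaussian v 0).map (fun z ↦ m + z)).real F := by
  rw [isoGaussian_zero_map_add]

/-- The innovation of the bridge between the times `s < r`: the increment left after the linear
prediction of the centred position at time `r` from the centred position at time `s`. -/
def bridgeInnovation (lam T : ℝ) (b : EuclideanSpace ℝ (Fin d))
    (Z : Set.Icc (0 : ℝ) T → Ω → EuclideanSpace ℝ (Fin d)) (s r : Set.Icc (0 : ℝ) T) (ω : Ω) :
    EuclideanSpace ℝ (Fin d) :=
  (Z r ω - bridgeMean lam T b r) -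
    (Real.sinh (lam * (T - r)) / Real.sinh (lam * (T - s))) • (Z s ω - bridgeMean lam T b s)

/-- Conditioning on the past alone is the Bernstein property with the deterministic final position
as the future: the innovation is Gaussian and independent of the past. -/
lemma IsOscillatorBridge.indep_innovation [IsProbabilityMeasure P] (hlam : 0 < lam) {hT : 0 < T}
    (hZ : IsOscillatorBridge hT lam b Z P) {s r : Set.Icc (0 : ℝ) T} (hsr : s < r) :
    Indep (pastField Z s)
        (MeasurableSpace.comap (bridgeInnovation lam T b Z s r) inferInstance) P ∧
      P.map (bridgeInnovation lam T b Z s r) =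
        isoGaussian (bridgeVariance lam (T - s) (r - s)) 0 := by
  let e : Set.Icc (0 : ℝ) T := ⟨T, Set.right_mem_Icc.2 hT.le⟩
  have hend : ∀ᵐ ω ∂P, Z e ω = b := (hZ.ae_start_and_end hlam).2
  have hsr' : (s : ℝ) < r := hsr
  have hrT : (r : ℝ) ≤ T := r.2.2
  have hS := sinh_mul_pos hlam (sub_pos.2 (hsr'.trans_le hrT))
  let X : Ω → EuclideanSpace ℝ (Fin d) := fun ω ↦
    (Real.sinh (lam * (T - r)) / Real.sinh (lam * (T - s))) • Z s ω +
      (Real.sinh (lam * (r - s)) / Real.sinh (lam * (T - s))) • b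
  have hX : Measurable[pastField Z s ⊔ futureField Z e] X := by
    have h1 : Measurable[pastField Z s ⊔ futureField Z e] (Z s) :=
      (measurable_presentField s).mono
        ((presentField_le_pastField le_rfl).trans le_sup_left) le_rfl
    have h2 : Measurable (fun x : EuclideanSpace ℝ (Fin d) ↦
        (Real.sinh (lam * (T - r)) / Real.sinh (lam * (T - s))) • x +
          (Real.sinh (lam * (r - s)) / Real.sinh (lam * (T - s))) • b) := by fun_prop
    exact h2.comp h1
  have hle : pastField Z s ⊔ futureField Z e ≤ mΩ :=
    sup_le (pastField_le hZ.measurable s) (futureField_le hZ.measurable e)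
  have hε : (fun ω ↦ Z r ω - X ω) = bridgeInnovation lam T b Z s r := by
    ext1 ω
    have h := bridgeMean_interpolation (T := T) (r := r) hlam b (hsr'.trans_le hrT)
    rw [bridgeMean_self hlam hT] at h
    simp only [X, bridgeInnovation]
    rw [h, smul_sub]
    abel
  have key := indep_sub_of_condExp_indicator (P := P) hle hX (hZ.measurable r)
    (isoGaussian (bridgeVariance lam (T - s) (r - s)) 0) ?_
  · rw [hε] at key
    exact ⟨indep_of_indep_of_le_left key.1 le_sup_left, key.2⟩
  intro F hF
  simp_rw [← isoGaussian_real_eq_map]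
  -- The Bernstein property does not cover `r = T`, where the position is deterministic.
  rcases hrT.lt_or_eq with hrT | hrT
  · have hre : r < e := hrT
    have h1 := hZ.bernstein s r e hsr hre (F.indicator fun _ ↦ 1)
      (measurable_const.indicator hF) ⟨1, fun x ↦ by by_cases h : x ∈ F <;> simp [h]⟩
    have h2 := hZ.transition s r e hsr hre F hF
    have hint : Integrable ((Z r ⁻¹' F).indicator fun _ ↦ (1 : ℝ)) P :=
      (integrable_const 1).indicator (hZ.measurable r hF)
    have hco : (fun ω ↦ F.indicator (fun _ ↦ (1 : ℂ)) (Z r ω)) =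
        fun ω ↦ (((Z r ⁻¹' F).indicator (fun _ ↦ (1 : ℝ)) ω : ℝ) : ℂ) := by
      ext ω
      by_cases h : Z r ω ∈ F <;> simp [Set.indicator, h]
    rw [hco] at h1
    filter_upwards [h1, h2, hend, condExp_ofReal (m := pastField Z s ⊔ futureField Z e) hint,
      condExp_ofReal (m := presentField Z s ⊔ presentField Z e) hint] with ω h1 h2 h3 h4 h5
    rw [h4, h5] at h1
    rw [Complex.ofReal_injective h1, h2, h3,
      twoSidedTransition_mehlerKernel hlam hsr' hrT _ _ hF]
  · have hre : r = e := Subtype.ext hrT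
    have h1 : (Z r ⁻¹' F).indicator (fun _ ↦ (1 : ℝ)) =ᵐ[P]
        fun _ ↦ F.indicator (fun _ ↦ (1 : ℝ)) b := by
      filter_upwards [hend] with ω hω
      rw [← hre] at hω
      by_cases h : b ∈ F <;> simp [Set.indicator, h, hω]
    refine (condExp_congr_ae h1).trans ?_
    rw [condExp_const hle]
    filter_upwards with ω
    have hX' : X ω = b := by
      simp only [X, hrT, sub_self, mul_zero, Real.sinh_zero, zero_div, zero_smul, zero_add]
      rw [div_self hS.ne', one_smul]
    have hv : bridgeVariance lam (T - s) (r - s) = 0 := by simp [bridgeVariance, hrT]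
    rw [hX', hv, isoGaussian_zero_left, measureReal_def, Measure.dirac_apply' _ hF]
    by_cases h : b ∈ F <;> simp [h]

end BridgeLaws

/-! ### The Bernstein bridge: Gaussianity, Markov property and moments -/

section BridgeProperties

variable {d : ℕ} {T lam : ℝ} {Ω : Type*} {mΩ : MeasurableSpace Ω} {P : Measure Ω}
  [IsProbabilityMeasure P]
  {Z : Set.Icc (0 : ℝ) T → Ω → EuclideanSpace ℝ (Fin d)} {b : EuclideanSpace ℝ (Fin d)}

lemma measurable_bridgeInnovation (hZ : ∀ t, Measurable (Z t)) (s r : Set.Icc (0 : ℝ) T) :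
    Measurable (bridgeInnovation lam T b Z s r) :=
  Measurable.sub ((hZ r).sub_const _) (((hZ s).sub_const _).const_smul
    (Real.sinh (lam * (T - r)) / Real.sinh (lam * (T - s))))

/-- The centred positions form a Gaussian process: times are added to a finite set in increasing
order, each new position being a linear function of the preceding one and of an independent
Gaussian innovation. -/
lemma IsOscillatorBridge.isGaussianProcess_centred (hlam : 0 < lam) {hT : 0 < T}
    (hZ : IsOscillatorBridge hT lam b Z P) :
    IsGaussianProcess (fun t ω ↦ Z t ω - bridgeMean lam T b t) P where
  hasGaussianLaw I := by
    let o : Set.Icc (0 : ℝ) T := ⟨0, Set.left_mem_Icc.2 hT.le⟩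
    have hstart : ∀ᵐ ω ∂P, Z o ω - bridgeMean lam T b o = 0 := by
      filter_upwards [(hZ.ae_start_and_end hlam).1] with ω hω
      rw [hω, bridgeMean_zero, sub_zero]
    induction I using Finset.induction_on_max with
    | empty => exact .of_subsingleton
    | insert a I hI ih =>
      by_cases ha : a = o
      · have hconst : HasGaussianLaw
            (fun _ : Ω ↦ (0 : {i // i ∈ insert a I} → EuclideanSpace ℝ (Fin d))) P :=
          ⟨by rw [Measure.map_const, measure_univ, one_smul]; infer_instance⟩
        refine hconst.congr ?_
        filter_upwards [hstart] with ω hω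
        ext1 i
        have hi : i.1 = o := by
          rcases Finset.mem_insert.1 i.2 with h | h
          · rw [h, ha]
          · exact absurd ((hI _ h).trans_le ha.le) (not_lt.2 i.1.2.1)
        rw [Finset.restrict, hi, hω]
        rfl
      · have hoa : o < a := lt_of_le_of_ne a.2.1 (Ne.symm ha)
        obtain ⟨s, hsa, hIs, L, hL⟩ : ∃ s : Set.Icc (0 : ℝ) T, s < a ∧ (∀ i ∈ I, i ≤ s) ∧
            ∃ L : (I → EuclideanSpace ℝ (Fin d)) →L[ℝ] EuclideanSpace ℝ (Fin d),
              ∀ᵐ ω ∂P, Z s ω - bridgeMean lam T b s =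
                L (I.restrict fun t ↦ Z t ω - bridgeMean lam T b t) := by
          rcases I.eq_empty_or_nonempty with h | h
          · refine ⟨o, hoa, by simp [h], 0, ?_⟩
            filter_upwards [hstart] with ω hω
            simpa using hω
          · exact ⟨I.max' h, hI _ (I.max'_mem h), fun i hi ↦ I.le_max' i hi,
              ContinuousLinearMap.proj ⟨I.max' h, I.max'_mem h⟩, ae_of_all _ fun ω ↦ rfl⟩
        obtain ⟨hind, hlaw⟩ := hZ.indep_innovation hlam hsa
        have hεm := measurable_bridgeInnovation (lam := lam) (b := b) hZ.measurable s a
        have hεg : HasGaussianLaw (bridgeInnovation lam T b Z s a) P := ⟨by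
          rw [hlaw]; infer_instance⟩
        have hIm := measurable_pastField_restrict (Z := Z) hIs fun t ↦ bridgeMean lam T b t
        have hpair := IndepFun.hasGaussianLaw ih hεg ((IndepFun_iff_Indep _ _ _).2
          (indep_of_indep_of_le_left hind hIm.comap_le))
        classical
        let K : ((I → EuclideanSpace ℝ (Fin d)) × EuclideanSpace ℝ (Fin d)) →L[ℝ]
            ({i // i ∈ insert a I} → EuclideanSpace ℝ (Fin d)) :=
          ContinuousLinearMap.pi fun j ↦
            if h : j.1 ∈ I then
              (ContinuousLinearMap.proj (R := ℝ) (φ := fun _ : I ↦ EuclideanSpace ℝ (Fin d))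
                ⟨j.1, h⟩).comp (ContinuousLinearMap.fst ℝ _ _)
            else (Real.sinh (lam * (T - a)) / Real.sinh (lam * (T - s))) •
              L.comp (ContinuousLinearMap.fst ℝ _ _) + ContinuousLinearMap.snd ℝ _ _
        refine (hpair.map K).congr ?_
        filter_upwards [hL] with ω hω
        ext1 j
        by_cases h : j.1 ∈ I
        · simp [K, h]
        · have hj : j.1 = a := (Finset.mem_insert.1 j.2).resolve_right h
          simp only [K, Function.comp_apply, ContinuousLinearMap.pi_apply, h, dite_false]
          change (Real.sinh (lam * (T - a)) / Real.sinh (lam * (T - s))) •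
            L (I.restrict fun t ↦ Z t ω - bridgeMean lam T b t) +
              bridgeInnovation lam T b Z s a ω = _
          rw [← hω, Finset.restrict, hj, bridgeInnovation]
          abel

lemma IsOscillatorBridge.isGaussianProcess (hlam : 0 < lam) {hT : 0 < T}
    (hZ : IsOscillatorBridge hT lam b Z P) : IsGaussianProcess Z P where
  hasGaussianLaw I := by
    have h := (hZ.isGaussianProcess_centred hlam).hasGaussianLaw I
    have hg := h.isGaussian_map
    let c : I → EuclideanSpace ℝ (Fin d) := fun i ↦ bridgeMean lam T b i.1
    have h2 : P.map (fun ω ↦ I.restrict (Z · ω)) =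
        (P.map (fun ω ↦ I.restrict fun t ↦ Z t ω - bridgeMean lam T b t)).map (fun x ↦ x + c) := by
      rw [AEMeasurable.map_map_of_aemeasurable (by fun_prop) h.aemeasurable]
      congr 1
      ext1 ω
      ext1 i
      simp [c]
    exact ⟨by rw [h2]; infer_instance⟩

lemma IsOscillatorBridge.hasMarkovProperty (hlam : 0 < lam) {hT : 0 < T}
    (hZ : IsOscillatorBridge hT lam b Z P) : HasMarkovProperty Z P := by
  rintro s t hst f hf ⟨C, hC⟩
  obtain ⟨hind, -⟩ := hZ.indep_innovation hlam hst
  let X : Ω → EuclideanSpace ℝ (Fin d) := fun ω ↦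
    (Real.sinh (lam * (T - t)) / Real.sinh (lam * (T - s))) • (Z s ω - bridgeMean lam T b s) +
      bridgeMean lam T b t
  have hX : Measurable[presentField Z s] X := by
    have h1 : Measurable (fun x : EuclideanSpace ℝ (Fin d) ↦
        (Real.sinh (lam * (T - t)) / Real.sinh (lam * (T - s))) • (x - bridgeMean lam T b s) +
          bridgeMean lam T b t) := by fun_prop
    exact h1.comp (measurable_presentField s)
  have hle := presentField_le_pastField (Z := Z) (le_refl s)
  have hεm := measurable_bridgeInnovation (lam := lam) (b := b) hZ.measurable s t
  have h1 := condExp_comp_add_of_indep (P := P) (pastField_le hZ.measurable s)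
    (hX.mono hle le_rfl) hεm hind hf.stronglyMeasurable hC
  have h2 := condExp_comp_add_of_indep (P := P) (presentField_le hZ.measurable s) hX hεm
    (indep_of_indep_of_le_left hind hle) hf.stronglyMeasurable hC
  have h3 : ∀ ω, X ω + bridgeInnovation lam T b Z s t ω = Z t ω := by
    intro ω
    simp only [X, bridgeInnovation]
    abel
  simp_rw [h3] at h1 h2
  exact h1.trans h2.symm

lemma IsOscillatorBridge.map_eq (hlam : 0 < lam) {hT : 0 < T}
    (hZ : IsOscillatorBridge hT lam b Z P) (t : Set.Icc (0 : ℝ) T) :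
    P.map (Z t) = isoGaussian (bridgeVariance lam T t) (bridgeMean lam T b t) := by
  let o : Set.Icc (0 : ℝ) T := ⟨0, Set.left_mem_Icc.2 hT.le⟩
  have hstart : Z o =ᵐ[P] fun _ ↦ 0 := (hZ.ae_start_and_end hlam).1
  by_cases ht : t = o
  · rw [ht, Measure.map_congr hstart, Measure.map_const, measure_univ, one_smul]
    simp [o, bridgeVariance, bridgeMean_zero, isoGaussian_zero_left]
  · have hot : o < t := lt_of_le_of_ne t.2.1 (Ne.symm ht)
    have hlaw := (hZ.indep_innovation hlam hot).2
    have h1 : Z t =ᵐ[P] (fun z ↦ bridgeMean lam T b t + z) ∘ bridgeInnovation lam T b Z o t := by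
      filter_upwards [hstart] with ω hω
      simp [bridgeInnovation, hω, o, bridgeMean_zero]
    rw [Measure.map_congr h1, ← Measure.map_map (by fun_prop)
      (measurable_bridgeInnovation hZ.measurable o t), hlaw, isoGaussian_zero_map_add]
    simp [o]

lemma IsOscillatorBridge.integral_eq (hlam : 0 < lam) {hT : 0 < T}
    (hZ : IsOscillatorBridge hT lam b Z P) (t : Set.Icc (0 : ℝ) T) :
    ∫ ω, Z t ω ∂P = bridgeMean lam T b t := by
  rw [← integral_id_isoGaussian (bridgeVariance lam T t) (bridgeMean lam T b t),
    ← hZ.map_eq hlam t, integral_map (hZ.measurable t).aemeasurable (by fun_prop)]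

lemma IsOscillatorBridge.integrable_mul (hlam : 0 < lam) {hT : 0 < T}
    (hZ : IsOscillatorBridge hT lam b Z P) (s t : Set.Icc (0 : ℝ) T) (i j : Fin d) :
    Integrable (fun ω ↦ (Z s ω i - bridgeMean lam T b s i) *
      (Z t ω j - bridgeMean lam T b t j)) P := by
  have h : ∀ (t : Set.Icc (0 : ℝ) T) (i : Fin d),
      MemLp (fun ω ↦ Z t ω i - bridgeMean lam T b t i) 2 P := fun t i ↦
    (((hZ.isGaussianProcess_centred hlam).hasGaussianLaw_eval t).map_fun
      (EuclideanSpace.proj i : EuclideanSpace ℝ (Fin d) →L[ℝ] ℝ)).memLp_two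
  exact (h s i).integrable_mul (h t j)

lemma IsOscillatorBridge.covariance_eq (hlam : 0 < lam) {hT : 0 < T}
    (hZ : IsOscillatorBridge hT lam b Z P) {s t : Set.Icc (0 : ℝ) T} (hst : s ≤ t) (i j : Fin d) :
    ∫ ω, (Z s ω i - bridgeMean lam T b s i) * (Z t ω j - bridgeMean lam T b t j) ∂P =
      Real.sinh (lam * (T - t)) * Real.sinh (lam * s) / (lam * Real.sinh (lam * T)) *
        (if i = j then 1 else 0) := by
  have hdiag : ∀ k, ∫ ω, (Z s ω i - bridgeMean lam T b s i) *
      (Z s ω k - bridgeMean lam T b s k) ∂P =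
      bridgeVariance lam T s * (if i = k then 1 else 0) := by
    intro k
    have h1 : P.map (fun ω ↦ -bridgeMean lam T b s + Z s ω) =
        isoGaussian (bridgeVariance lam T s) 0 := by
      have h2 := congrArg (Measure.map (fun z ↦ -bridgeMean lam T b s + z)) (hZ.map_eq hlam s)
      rw [Measure.map_map (by fun_prop) (hZ.measurable s), ← isoGaussian_zero_map_add,
        Measure.map_map (by fun_prop) (by fun_prop)] at h2
      simpa [Function.comp_def] using h2
    rw [← integral_mul_isoGaussian (bridgeVariance_nonneg hlam s.2.1 s.2.2), ← h1,
      integral_map ((hZ.measurable s).const_add _).aemeasurable (by fun_prop)]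
    refine integral_congr_ae (ae_of_all _ fun ω ↦ ?_)
    simp only [PiLp.add_apply, PiLp.neg_apply]
    ring
  rcases hst.eq_or_lt with rfl | hst
  · rw [hdiag]
    rfl
  obtain ⟨hind, hlaw⟩ := hZ.indep_innovation hlam hst
  have hεm := measurable_bridgeInnovation (lam := lam) (b := b) hZ.measurable s t
  have hst' : (s : ℝ) < t := hst
  have hS := sinh_mul_pos hlam (sub_pos.2 (hst'.trans_le t.2.2))
  have hind' : IndepFun (fun ω ↦ Z s ω i - bridgeMean lam T b s i)
      (fun ω ↦ bridgeInnovation lam T b Z s t ω j) P := by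
    have h1 : IndepFun (Z s) (bridgeInnovation lam T b Z s t) P :=
      (IndepFun_iff_Indep _ _ _).2
        (indep_of_indep_of_le_left hind (presentField_le_pastField le_rfl))
    exact h1.comp (φ := fun x ↦ x i - bridgeMean lam T b s i) (ψ := fun x ↦ x j)
      (by fun_prop) (by fun_prop)
  have hε0 : ∫ ω, bridgeInnovation lam T b Z s t ω j ∂P = 0 := by
    have h1 : ∫ x, x j ∂(isoGaussian (bridgeVariance lam (T - s) (t - s))
        (0 : EuclideanSpace ℝ (Fin d))) = 0 := by
      have h2 := (EuclideanSpace.proj j : EuclideanSpace ℝ (Fin d) →L[ℝ] ℝ).integral_comp_comm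
        (IsGaussian.integrable_fun_id
          (μ := isoGaussian (bridgeVariance lam (T - s) (t - s)) (0 : EuclideanSpace ℝ (Fin d))))
      rw [integral_id_isoGaussian] at h2
      simpa using h2
    rw [← h1, ← hlaw, integral_map hεm.aemeasurable (by fun_prop)]
  have hdec : ∀ ω, (Z s ω i - bridgeMean lam T b s i) * (Z t ω j - bridgeMean lam T b t j) =
      Real.sinh (lam * (T - t)) / Real.sinh (lam * (T - s)) *
        ((Z s ω i - bridgeMean lam T b s i) * (Z s ω j - bridgeMean lam T b s j)) +
      (Z s ω i - bridgeMean lam T b s i) * bridgeInnovation lam T b Z s t ω j := by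
    intro ω
    simp only [bridgeInnovation, PiLp.sub_apply, PiLp.smul_apply, smul_eq_mul]
    ring
  have hprod : ∫ ω, (Z s ω i - bridgeMean lam T b s i) *
      bridgeInnovation lam T b Z s t ω j ∂P = 0 := by
    rw [hind'.integral_fun_mul_eq_mul_integral, hε0, mul_zero]
    · have := hZ.measurable s
      exact Measurable.aestronglyMeasurable (by fun_prop)
    · exact Measurable.aestronglyMeasurable (by fun_prop)
  have hint := (hZ.integrable_mul hlam s s i j).const_mul
    (Real.sinh (lam * (T - t)) / Real.sinh (lam * (T - s)))
  have hint' : Integrable (fun ω ↦ (Z s ω i - bridgeMean lam T b s i) *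
      bridgeInnovation lam T b Z s t ω j) P := by
    refine ((hZ.integrable_mul hlam s t i j).sub hint).congr (ae_of_all _ fun ω ↦ ?_)
    simp only [Pi.sub_apply]
    rw [hdec]
    ring
  simp_rw [hdec]
  rw [integral_add hint hint', hprod, add_zero, integral_const_mul, hdiag, bridgeVariance]
  field_simp

lemma IsOscillatorBridge.not_isStationaryProcess (hd : 0 < d) (hlam : 0 < lam) {hT : 0 < T}
    (hZ : IsOscillatorBridge hT lam b Z P) : ¬ IsStationaryProcess Z P := by
  intro hstat
  have : NeZero d := ⟨hd.ne'⟩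
  let t : Set.Icc (0 : ℝ) T := ⟨T / 4, by constructor <;> linarith⟩
  let t' : Set.Icc (0 : ℝ) T := ⟨T / 2, by constructor <;> linarith⟩
  have h1 := hstat 1 (T / 4) (fun _ ↦ t) (fun _ ↦ t')
    (fun _ ↦ by constructor <;> simp only [t] <;> linarith)
    (fun _ ↦ by constructor <;> simp only [t'] <;> linarith)
    (fun _ ↦ by simp only [t, t']; ring)
  have h2 := congrArg (Measure.map (fun x : Fin 1 → EuclideanSpace ℝ (Fin d) ↦ x 0)) h1
  have hm := hZ.measurable
  rw [Measure.map_map (by fun_prop) (by fun_prop),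
    Measure.map_map (by fun_prop) (by fun_prop)] at h2
  have h3 : P.map (Z t') = P.map (Z t) := h2
  rw [hZ.map_eq hlam, hZ.map_eq hlam] at h3
  have h4 := variance_eq_of_isoGaussian_eq (bridgeVariance_nonneg hlam t'.2.1 t'.2.2)
    (bridgeVariance_nonneg hlam t.2.1 t.2.2) h3
  -- The variances differ by a multiple of `sinh² (λT/4)`.
  have hS := sinh_mul_pos hlam hT
  have hS4 := sinh_mul_pos hlam (show 0 < T / 4 by linarith)
  rw [bridgeVariance, bridgeVariance, div_left_inj' (by positivity)] at h4
  have e1 : lam * (T - T / 2) = 2 * (lam * (T / 4)) := by ring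
  have e2 : lam * (T / 2) = 2 * (lam * (T / 4)) := by ring
  have e3 : lam * (T - T / 4) = 3 * (lam * (T / 4)) := by ring
  simp only [t, t', e1, e2, e3, Real.sinh_two_mul, Real.sinh_three_mul] at h4
  have h5 : Real.sinh (lam * (T / 4)) ^ 2 = 0 := by
    linear_combination h4 - 4 * Real.sinh (lam * (T / 4)) ^ 2 * Real.cosh_sq (lam * (T / 4))
  exact (pow_pos hS4 2).ne' h5

end BridgeProperties

/-! ### Isonormal Gaussian processes -/

section Isonormal

variable {Ω : Type*} {mΩ : MeasurableSpace Ω} {P : Measure Ω}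

/-- An `L²` limit of centred Gaussian variables is a centred Gaussian variable. -/
lemma isClosed_setOf_map_eq_gaussianReal [IsProbabilityMeasure P] :
    IsClosed {X : Lp ℝ 2 P | P.map X = gaussianReal 0 (‖X‖₊ ^ 2)} := by
  refine isSeqClosed_iff_isClosed.1 fun X Y hX hXY ↦ ?_
  -- Characteristic functions converge along a subsequence which converges almost surely.
  obtain ⟨ns, hns, hae⟩ := (tendstoInMeasure_of_tendsto_Lp hXY).exists_seq_tendsto_ae
  have hYm : AEMeasurable Y P := (Lp.aestronglyMeasurable Y).aemeasurable
  have : IsProbabilityMeasure (P.map Y) := Measure.isProbabilityMeasure_map hYm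
  refine Measure.ext_of_charFun ?_
  ext1 u
  have hchar : ∀ Z : Lp ℝ 2 P,
      charFun (P.map Z) u = ∫ ω, Complex.exp (u * (Z ω : ℂ) * Complex.I) ∂P := fun Z ↦ by
    rw [charFun_apply_real,
      integral_map (Lp.aestronglyMeasurable Z).aemeasurable (by fun_prop)]
  have h1 : Tendsto (fun k ↦ charFun (P.map (X (ns k))) u) atTop
      (𝓝 (charFun (P.map Y) u)) := by
    simp_rw [hchar]
    refine tendsto_integral_of_dominated_convergence (fun _ ↦ 1) (fun k ↦ ?_)
      (integrable_const _) (fun k ↦ ae_of_all _ fun ω ↦ ?_) ?_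
    · have h : Continuous fun x : ℝ ↦ Complex.exp (u * (x : ℂ) * Complex.I) := by fun_prop
      exact h.comp_aestronglyMeasurable (Lp.aestronglyMeasurable _)
    · rw [← Complex.ofReal_mul, Complex.norm_exp_ofReal_mul_I]
    · filter_upwards [hae] with ω hω
      have h : Continuous fun x : ℝ ↦ Complex.exp (u * (x : ℂ) * Complex.I) := by fun_prop
      exact (h.tendsto _).comp hω
  refine tendsto_nhds_unique h1 ?_
  have h2 : ∀ k, charFun (P.map (X (ns k))) u =
      charFun (gaussianReal 0 (‖X (ns k)‖₊ ^ 2)) u := fun k ↦ by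
    rw [show P.map (X (ns k)) = _ from hX (ns k)]
  simp_rw [h2, charFun_gaussianReal]
  have h3 : Tendsto (fun k ↦ ‖X (ns k)‖₊) atTop (𝓝 ‖Y‖₊) :=
    (hXY.comp hns.tendsto_atTop).nnnorm
  have h4 : Continuous fun v : NNReal ↦
      Complex.exp (u * (0 : ℝ) * Complex.I - ((v ^ 2 : NNReal) : ℝ) * (u : ℂ) ^ 2 / 2) := by
    fun_prop
  exact (h4.tendsto _).comp h3

/-- Linear combinations of independent standard Gaussian variables are centred Gaussian
variables. -/
lemma map_sum_smul_eq_gaussianReal {ι : Type*} [IsProbabilityMeasure P] {ξ : ι → Lp ℝ 2 P}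
    (hg : ∀ i, P.map (ξ i) = gaussianReal 0 1)
    (hind : iIndepFun (fun i ω ↦ ξ i ω) P) (s : Finset ι) (c : ι → ℝ) :
    P.map (∑ i ∈ s, c i • ξ i : Lp ℝ 2 P) = gaussianReal 0 (‖∑ i ∈ s, c i • ξ i‖₊ ^ 2) := by
  set X : Lp ℝ 2 P := ∑ i ∈ s, c i • ξ i
  have hae : X =ᵐ[P] fun ω ↦ ∑ i : s, c i * ξ i ω := by
    refine (Lp.coeFn_finsetSum _ _).trans ?_
    have h : ∀ᵐ ω ∂P, ∀ i : s, (c i • ξ i : Lp ℝ 2 P) ω = c i * ξ i ω := by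
      rw [ae_all_iff]
      intro i
      filter_upwards [Lp.coeFn_smul (c i) (ξ i)] with ω hω
      rw [hω]
      rfl
    filter_upwards [h] with ω hω
    rw [Finset.sum_apply, ← Finset.sum_coe_sort]
    exact Finset.sum_congr rfl fun i _ ↦ hω i
  have hξg : ∀ i, HasGaussianLaw (ξ i) P := fun i ↦ ⟨by rw [hg i]; infer_instance⟩
  have hXg : HasGaussianLaw X P := by
    refine HasGaussianLaw.congr (X := fun ω ↦ ∑ i : s, c i * ξ i ω) ?_ hae.symm
    refine iIndepFun.hasGaussianLaw_fun_sum (fun i ↦ (hξg i).fun_smul (c i)) ?_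
    exact (hind.precomp (Subtype.val_injective (p := (· ∈ s)))).comp
      (fun i x ↦ c i.1 * x) fun i ↦ measurable_const_mul _
  have hmean : ∫ ω, X ω ∂P = 0 := by
    rw [integral_congr_ae hae, integral_finsetSum _ fun i _ ↦
      (hξg i.1).integrable.const_mul (c i.1)]
    refine Finset.sum_eq_zero fun i _ ↦ ?_
    have h : ∫ ω, ξ i ω ∂P = ∫ x, x ∂(P.map (ξ i)) := by
      rw [integral_map (hξg i).aemeasurable (by fun_prop)]
    rw [integral_const_mul, h, hg, integral_id_gaussianReal, mul_zero]
  have hvar : Var[X; P] = ‖X‖ ^ 2 := by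
    rw [variance_of_integral_eq_zero hXg.aemeasurable hmean, ← real_inner_self_eq_norm_sq,
      L2.inner_def]
    simp [sq]
  rw [hXg.map_eq_gaussianReal, hmean, hvar]
  congr 1
  ext
  simp

/-- Every real Hilbert space carries an isonormal Gaussian process: it embeds isometrically into
a Gaussian Hilbert space, by sending a Hilbert basis to independent standard Gaussian variables. -/
lemma exists_isonormal (H : Type) [NormedAddCommGroup H] [InnerProductSpace ℝ H]
    [CompleteSpace H] :
    ∃ (Ω : Type) (_ : MeasurableSpace Ω) (P : Measure Ω) (W : H →ₗᵢ[ℝ] Lp ℝ 2 P),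
      IsProbabilityMeasure P ∧ ∀ h, P.map (W h) = gaussianReal 0 (‖h‖₊ ^ 2) := by
  obtain ⟨ι, B, -⟩ := exists_hilbertBasis ℝ H
  let P : Measure (ι → ℝ) := Measure.infinitePi fun _ ↦ gaussianReal 0 1
  have hmp : ∀ i, MeasurePreserving (Function.eval i) P (gaussianReal 0 1) :=
    measurePreserving_eval_infinitePi _
  have hL : ∀ i, MemLp (Function.eval i : (ι → ℝ) → ℝ) 2 P := fun i ↦
    (memLp_id_gaussianReal 2).comp_measurePreserving (hmp i)
  let ξ : ι → Lp ℝ 2 P := fun i ↦ (hL i).toLp _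
  have hξ : ∀ i, ξ i =ᵐ[P] Function.eval i := fun i ↦ (hL i).coeFn_toLp
  have hg : ∀ i, P.map (ξ i) = gaussianReal 0 1 := fun i ↦ by
    rw [Measure.map_congr (hξ i), (hmp i).map_eq]
  have hind0 : iIndepFun (fun i (ω : ι → ℝ) ↦ ω i) P :=
    iIndepFun_infinitePi (X := fun _ x ↦ x) fun _ ↦ measurable_id
  have hind : iIndepFun (fun i ω ↦ ξ i ω) P := hind0.congr fun i ↦ (hξ i).symm
  have hmean : ∀ i, ∫ ω, ξ i ω ∂P = 0 := fun i ↦ by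
    have h : ∫ ω, ξ i ω ∂P = ∫ x, x ∂(P.map (ξ i)) := by
      rw [integral_map (Lp.aestronglyMeasurable _).aemeasurable (by fun_prop)]
    rw [h, hg, integral_id_gaussianReal]
  have hortho : Orthonormal ℝ ξ := by
    refine ⟨fun i ↦ ?_, fun i j hij ↦ ?_⟩
    · have h1 : ‖ξ i‖ ^ 2 = 1 := by
        rw [← real_inner_self_eq_norm_sq, L2.inner_def]
        have h := variance_of_integral_eq_zero (Lp.aestronglyMeasurable (ξ i)).aemeasurable
          (hmean i)
        rw [← variance_id_map (Lp.aestronglyMeasurable (ξ i)).aemeasurable, hg,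
          variance_id_gaussianReal] at h
        simpa [sq] using h.symm
      exact (pow_eq_one_iff_of_nonneg (norm_nonneg _) two_ne_zero).1 h1
    · beta_reduce
      rw [L2.inner_def]
      have h := (hind.indepFun hij).integral_fun_mul_eq_mul_integral
        (Lp.aestronglyMeasurable _) (Lp.aestronglyMeasurable _)
      rw [hmean, zero_mul] at h
      simpa [mul_comm] using h
  let W : H →ₗᵢ[ℝ] Lp ℝ 2 P :=
    hortho.orthogonalFamily.linearIsometry.comp B.repr.toLinearIsometry
  refine ⟨ι → ℝ, inferInstance, P, W, inferInstance, fun h ↦ ?_⟩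
  have hsum : HasSum (fun i ↦ B.repr h i • ξ i) (W h) :=
    hortho.orthogonalFamily.hasSum_linearIsometry (B.repr h)
  have hmem := isClosed_setOf_map_eq_gaussianReal.mem_of_tendsto hsum
    (Eventually.of_forall fun s ↦ map_sum_smul_eq_gaussianReal hg hind s fun i ↦ B.repr h i)
  have hnorm : ‖W h‖₊ = ‖h‖₊ := W.nnnorm_map h
  rw [← hnorm]
  exact hmem

variable {H : Type*} [NormedAddCommGroup H] [InnerProductSpace ℝ H] {W : H →ₗᵢ[ℝ] Lp ℝ 2 P}

/-- A linear combination of values of `W` is almost surely a value of `W`, hence Gaussian. -/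
lemma isGaussianProcess_isonormal [IsProbabilityMeasure P]
    (hW : ∀ h, P.map (W h) = gaussianReal 0 (‖h‖₊ ^ 2)) :
    IsGaussianProcess (fun h ω ↦ W h ω) P where
  hasGaussianLaw I := by
    have hm : AEMeasurable (fun ω ↦ I.restrict fun h ↦ W h ω) P :=
      aemeasurable_pi_lambda _ fun i ↦ (Lp.aestronglyMeasurable _).aemeasurable
    refine ⟨isGaussian_of_map_eq_gaussianReal fun L ↦ ?_⟩
    classical
    let k : H := ∑ i : I, L (Pi.single i 1) • (i : H)
    refine ⟨0, ‖k‖₊ ^ 2, ?_⟩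
    rw [AEMeasurable.map_map_of_aemeasurable (by fun_prop) hm, ← hW k]
    refine Measure.map_congr ?_
    have h1 : W k = ∑ i : I, L (Pi.single i 1) • W i := by simp [k]
    have h2 : ∀ᵐ ω ∂P, ∀ i : I,
        (L (Pi.single i 1) • W i : Lp ℝ 2 P) ω = L (Pi.single i 1) * W i ω := by
      rw [ae_all_iff]
      intro i
      filter_upwards [Lp.coeFn_smul (L (Pi.single i 1)) (W i)] with ω hω
      rw [hω]
      rfl
    rw [h1]
    filter_upwards [h2, Lp.coeFn_finsetSum Finset.univ
      fun i : I ↦ (L (Pi.single i 1) • W i : Lp ℝ 2 P)] with ω h2 h3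
    rw [h3, Finset.sum_apply]
    simp_rw [h2]
    have h4 := L.toLinearMap.pi_apply_eq_sum_univ (I.restrict fun h ↦ W h ω)
    refine h4.trans (Finset.sum_congr rfl fun i _ ↦ ?_)
    have h5 : (fun j ↦ if i = j then (1 : ℝ) else 0) = Pi.single i 1 := by
      ext j
      simp [Pi.single_apply, eq_comm]
    rw [h5, smul_eq_mul, mul_comm]
    rfl

end Isonormal

/-! ### Gaussian processes with the covariance of the bridge -/

section GaussianBridge

variable {d : ℕ} {T lam : ℝ} {Ω : Type*} {mΩ : MeasurableSpace Ω} {P : Measure Ω}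

/-- For `v = 0` the conclusion is that `Y` vanishes almost surely. -/
lemma HasGaussianLaw.map_eq_isoGaussian {Y : Ω → EuclideanSpace ℝ (Fin d)}
    (hY : HasGaussianLaw Y P) {v : ℝ} (hv : 0 ≤ v) (hmean : ∀ x, ∫ ω, inner ℝ x (Y ω) ∂P = 0)
    (hvar : ∀ x, ∫ ω, inner ℝ x (Y ω) * inner ℝ x (Y ω) ∂P = v * inner ℝ x x) :
    P.map Y = isoGaussian v 0 := by
  have := hY.isGaussian_map
  have := hY.isProbabilityMeasure
  refine Measure.ext_of_charFun ?_
  ext1 x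
  rw [hY.charFun_map_eq, charFun_isoGaussian hv, variance_of_integral_eq_zero
    (hY.aemeasurable.const_inner) (hmean x)]
  simp only [hmean x, sq, hvar x, real_inner_self_eq_norm_sq]
  congr 1
  push_cast
  ring

/-- `X` is a centred Gaussian process with the covariance function of the bridge (its components
are then independent, with a common law). Mean and covariance are given in a coordinate-free way,
the covariance for ordered pairs of times only. -/
structure IsCentredBridge (lam : ℝ) (X : Set.Icc (0 : ℝ) T → Ω → EuclideanSpace ℝ (Fin d))
    (P : Measure Ω) : Prop where
  measurable : ∀ t, Measurable (X t)
  gaussian : IsGaussianProcess X P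
  mean : ∀ t x, ∫ ω, inner ℝ x (X t ω) ∂P = 0
  covariance : ∀ s t, s ≤ t → ∀ x y, ∫ ω, inner ℝ x (X s ω) * inner ℝ y (X t ω) ∂P =
    Real.sinh (lam * (T - t)) * Real.sinh (lam * s) / (lam * Real.sinh (lam * T)) * inner ℝ x y

/-- The deviation of the position at time `r` from its linear interpolation between the times
`s` and `t`. -/
def interpolationError (lam : ℝ) (X : Set.Icc (0 : ℝ) T → Ω → EuclideanSpace ℝ (Fin d))
    (s r t : Set.Icc (0 : ℝ) T) (ω : Ω) : EuclideanSpace ℝ (Fin d) :=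
  X r ω - ((Real.sinh (lam * (t - r)) / Real.sinh (lam * (t - s))) • X s ω +
    (Real.sinh (lam * (r - s)) / Real.sinh (lam * (t - s))) • X t ω)

namespace IsCentredBridge

variable {X : Set.Icc (0 : ℝ) T → Ω → EuclideanSpace ℝ (Fin d)}

lemma measurable_interpolationError (hX : IsCentredBridge lam X P) (s r t : Set.Icc (0 : ℝ) T) :
    Measurable (interpolationError lam X s r t) :=
  (hX.measurable r).sub (((hX.measurable s).const_smul
    (Real.sinh (lam * (t - r)) / Real.sinh (lam * (t - s)))).add ((hX.measurable t).const_smul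
    (Real.sinh (lam * (r - s)) / Real.sinh (lam * (t - s)))))

lemma memLp_inner (hX : IsCentredBridge lam X P) (t : Set.Icc (0 : ℝ) T)
    (x : EuclideanSpace ℝ (Fin d)) : MemLp (fun ω ↦ inner ℝ x (X t ω)) 2 P :=
  ((hX.gaussian.hasGaussianLaw_eval t).map_fun (innerSL ℝ x)).memLp_two

lemma inner_interpolationError (s r t : Set.Icc (0 : ℝ) T) (x : EuclideanSpace ℝ (Fin d)) (ω : Ω) :
    inner ℝ x (interpolationError lam X s r t ω) = inner ℝ x (X r ω) -
      (Real.sinh (lam * (t - r)) / Real.sinh (lam * (t - s)) * inner ℝ x (X s ω) +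
        Real.sinh (lam * (r - s)) / Real.sinh (lam * (t - s)) * inner ℝ x (X t ω)) := by
  rw [interpolationError, inner_sub_right, inner_add_right, inner_smul_right, inner_smul_right]

lemma memLp_inner_interpolationError (hX : IsCentredBridge lam X P) (s r t : Set.Icc (0 : ℝ) T)
    (x : EuclideanSpace ℝ (Fin d)) :
    MemLp (fun ω ↦ inner ℝ x (interpolationError lam X s r t ω)) 2 P := by
  simp_rw [inner_interpolationError]
  exact (hX.memLp_inner r x).sub
    (((hX.memLp_inner s x).const_mul _).add ((hX.memLp_inner t x).const_mul _))

lemma integral_inner_interpolationError (hX : IsCentredBridge lam X P)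
    (s r t : Set.Icc (0 : ℝ) T) (x : EuclideanSpace ℝ (Fin d)) :
    ∫ ω, inner ℝ x (interpolationError lam X s r t ω) ∂P = 0 := by
  have := hX.gaussian.isProbabilityMeasure
  have h : ∀ τ (c : ℝ), Integrable (fun ω ↦ c * inner ℝ x (X τ ω)) P := fun τ c ↦
    ((hX.memLp_inner τ x).integrable one_le_two).const_mul c
  simp_rw [inner_interpolationError]
  rw [integral_sub (by simpa using h r 1) ((h s _).fun_add (h t _)),
    integral_add (h s _) (h t _), integral_const_mul, integral_const_mul, hX.mean, hX.mean, hX.mean]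
  simp

lemma integral_inner_mul_interpolationError (hX : IsCentredBridge lam X P)
    (s r t : Set.Icc (0 : ℝ) T) {f : Ω → ℝ} (hf : MemLp f 2 P) (y : EuclideanSpace ℝ (Fin d)) :
    ∫ ω, f ω * inner ℝ y (interpolationError lam X s r t ω) ∂P =
      ∫ ω, f ω * inner ℝ y (X r ω) ∂P -
        (Real.sinh (lam * (t - r)) / Real.sinh (lam * (t - s)) * ∫ ω, f ω * inner ℝ y (X s ω) ∂P +
          Real.sinh (lam * (r - s)) / Real.sinh (lam * (t - s)) *
            ∫ ω, f ω * inner ℝ y (X t ω) ∂P) := by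
  have h : ∀ τ (c : ℝ), Integrable (fun ω ↦ c * (f ω * inner ℝ y (X τ ω))) P := fun τ c ↦
    (hf.integrable_mul (hX.memLp_inner τ y)).const_mul c
  have hdec : ∀ p q r u a b : ℝ, p * (q - (a * r + b * u)) = p * q - (a * (p * r) + b * (p * u)) :=
    by intros; ring
  simp_rw [inner_interpolationError, hdec]
  rw [integral_sub (by simpa using h r 1) ((h s _).fun_add (h t _)),
    integral_add (h s _) (h t _), integral_const_mul, integral_const_mul]

/-- Outside the interval between the two reference times, the position is uncorrelated with the
interpolation error: on either side, the covariance function is a solution of `u'' = λ² u`. -/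
lemma integral_inner_mul_inner_interpolationError_eq_zero (hlam : 0 < lam)
    (hT : 0 < T) (hX : IsCentredBridge lam X P) {s r t τ : Set.Icc (0 : ℝ) T} (hsr : s < r) (hrt : r < t)
    (hτ : τ ≤ s ∨ t ≤ τ) (x y : EuclideanSpace ℝ (Fin d)) :
    ∫ ω, inner ℝ x (X τ ω) * inner ℝ y (interpolationError lam X s r t ω) ∂P = 0 := by
  have hS := sinh_mul_pos hlam (sub_pos.2 (show (s : ℝ) < t from hsr.trans hrt))
  have hST := sinh_mul_pos hlam hT
  rw [hX.integral_inner_mul_interpolationError s r t (hX.memLp_inner τ x)]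
  rcases hτ with h | h
  · rw [hX.covariance _ _ (h.trans hsr.le), hX.covariance _ _ h,
      hX.covariance _ _ (h.trans (hsr.trans hrt).le)]
    have e := sinh_sub_mul_sinh_add (lam * (T - t)) (lam * (T - s)) (lam * (T - r))
    rw [← mul_sub, ← mul_sub, ← mul_sub, sub_sub_sub_cancel_left, sub_sub_sub_cancel_left,
      sub_sub_sub_cancel_left] at e
    field_simp
    linear_combination (-inner ℝ x y * Real.sinh (lam * τ)) * e
  · simp_rw [mul_comm (inner ℝ x (X τ _))]
    rw [hX.covariance _ _ (hrt.le.trans h), hX.covariance _ _ ((hsr.trans hrt).le.trans h),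
      hX.covariance _ _ h]
    have e := sinh_sub_mul_sinh_add (lam * s) (lam * t) (lam * r)
    rw [← mul_sub, ← mul_sub, ← mul_sub] at e
    field_simp
    linear_combination (-inner ℝ y x * Real.sinh (lam * (T - τ))) * e

/-- The variance of the interpolation error is that of the bridge between the two reference
times. -/
lemma integral_inner_interpolationError_mul_self (hlam : 0 < lam) (hT : 0 < T)
    (hX : IsCentredBridge lam X P) {s r t : Set.Icc (0 : ℝ) T} (hsr : s < r) (hrt : r < t)
    (x : EuclideanSpace ℝ (Fin d)) :
    ∫ ω, inner ℝ x (interpolationError lam X s r t ω) *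
        inner ℝ x (interpolationError lam X s r t ω) ∂P =
      bridgeVariance lam (t - s) (r - s) * inner ℝ x x := by
  have hS := sinh_mul_pos hlam (sub_pos.2 (show (s : ℝ) < t from hsr.trans hrt))
  have hST := sinh_mul_pos hlam hT
  rw [hX.integral_inner_mul_interpolationError s r t (hX.memLp_inner_interpolationError s r t x)]
  simp_rw [mul_comm (inner ℝ x (interpolationError lam X s r t _))]
  rw [hX.integral_inner_mul_inner_interpolationError_eq_zero hlam hT hsr hrt (.inl le_rfl),
    hX.integral_inner_mul_inner_interpolationError_eq_zero hlam hT hsr hrt (.inr le_rfl),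
    hX.integral_inner_mul_interpolationError s r t (hX.memLp_inner r x)]
  simp_rw [mul_comm (inner ℝ x (X r _)) (inner ℝ x (X s _))]
  rw [hX.covariance _ _ le_rfl, hX.covariance _ _ hsr.le, hX.covariance _ _ hrt.le]
  have e1 := sinh_sub_mul_sinh_add (lam * s) (lam * t) (lam * r)
  have e2 := sinh_sub_mul_sinh_add (lam * r) (lam * T) (lam * t)
  simp only [← mul_sub] at e1 e2
  rw [bridgeVariance, sub_sub_sub_cancel_right]
  field_simp
  linear_combination (-inner ℝ x x * Real.sinh (lam * (T - r))) * e1 -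
    inner ℝ x x * Real.sinh (lam * (r - s)) * e2

/-- The interpolation error between two times is Gaussian and independent of the positions at all
times which are not between them. -/
lemma indep_interpolationError (hlam : 0 < lam) (hT : 0 < T) (hX : IsCentredBridge lam X P)
    {s r t : Set.Icc (0 : ℝ) T} (hsr : s < r) (hrt : r < t) :
    Indep (pastField X s ⊔ futureField X t)
        (MeasurableSpace.comap (interpolationError lam X s r t) inferInstance) P ∧
      P.map (interpolationError lam X s r t) =
        isoGaussian (bridgeVariance lam (t - s) (r - s)) 0 := by
  have := hX.gaussian.isProbabilityMeasure
  have hεm := hX.measurable_interpolationError s r t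
  let X' : {τ : Set.Icc (0 : ℝ) T // τ ≤ s ∨ t ≤ τ} → Ω → EuclideanSpace ℝ (Fin d) :=
    fun τ ↦ X τ
  let Y : Unit → Ω → EuclideanSpace ℝ (Fin d) := fun _ ↦ interpolationError lam X s r t
  have hgauss : IsGaussianProcess (Sum.elim X' Y) P := by
    classical
    refine hX.gaussian.of_isGaussianProcess ?_
    rintro (τ | -)
    · exact ⟨{τ.1}, ContinuousLinearMap.proj (R := ℝ)
        (φ := fun _ : ({τ.1} : Finset (Set.Icc (0 : ℝ) T)) ↦ EuclideanSpace ℝ (Fin d))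
        ⟨τ.1, by simp⟩, fun ω ↦ rfl⟩
    · let p : ∀ i : ({s, r, t} : Finset (Set.Icc (0 : ℝ) T)),
          (({s, r, t} : Finset (Set.Icc (0 : ℝ) T)) → EuclideanSpace ℝ (Fin d)) →L[ℝ]
            EuclideanSpace ℝ (Fin d) := fun i ↦ ContinuousLinearMap.proj i
      exact ⟨{s, r, t}, p ⟨r, by simp⟩ -
        ((Real.sinh (lam * (t - r)) / Real.sinh (lam * (t - s))) • p ⟨s, by simp⟩ +
          (Real.sinh (lam * (r - s)) / Real.sinh (lam * (t - s))) • p ⟨t, by simp⟩),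
        fun ω ↦ rfl⟩
  have hind := hgauss.indepFun_of_covariance_inner
    (fun τ ↦ (hX.measurable τ).aemeasurable) (fun _ ↦ hεm.aemeasurable) fun τ _ x y ↦ by
      rw [covariance_eq_sub (hX.memLp_inner τ x) (hX.memLp_inner_interpolationError s r t y),
        hX.mean, zero_mul, sub_zero]
      exact hX.integral_inner_mul_inner_interpolationError_eq_zero hlam hT hsr hrt τ.2 x y
  have hind' : IndepFun (fun ω τ ↦ X' τ ω) (interpolationError lam X s r t) P :=
    hind.comp (φ := id) (ψ := fun y : Unit → EuclideanSpace ℝ (Fin d) ↦ y ()) measurable_id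
      (measurable_pi_apply ())
  refine ⟨indep_of_indep_of_le_left ((IndepFun_iff_Indep _ _ _).1 hind') ?_,
    HasGaussianLaw.map_eq_isoGaussian ?_ ?_ (hX.integral_inner_interpolationError s r t)
      (hX.integral_inner_interpolationError_mul_self hlam hT hsr hrt)⟩
  · have hle : ∀ τ, τ ≤ s ∨ t ≤ τ → MeasurableSpace.comap (X τ) inferInstance ≤
        MeasurableSpace.comap (fun ω τ ↦ X' τ ω) inferInstance := fun τ hτ ↦
      ((measurable_pi_apply (⟨τ, hτ⟩ : {τ // τ ≤ s ∨ t ≤ τ})).comp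
        (comap_measurable fun ω τ ↦ X' τ ω)).comap_le
    exact sup_le (iSup₂_le fun τ hτ ↦ hle τ (.inl hτ)) (iSup₂_le fun τ hτ ↦ hle τ (.inr hτ))
  · exact hgauss.hasGaussianLaw_eval (.inr ())
  · exact bridgeVariance_nonneg hlam (sub_nonneg.2 (show (s : ℝ) ≤ r from hsr.le)) (sub_le_sub_right (show (r : ℝ) ≤ t from hrt.le) _)

/-- A Gaussian process with the mean and covariance of the bridge is a bridge: given the positions
outside an interval of time, a position inside is its linear interpolation plus the independent
Gaussian interpolation error, the law of which is that of the two-sided transition function. -/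
lemma isOscillatorBridge (hlam : 0 < lam) (hT : 0 < T) (hX : IsCentredBridge lam X P)
    (b : EuclideanSpace ℝ (Fin d)) :
    IsOscillatorBridge hT lam b (fun t ω ↦ bridgeMean lam T b t + X t ω) P := by
  have := hX.gaussian.isProbabilityMeasure
  set Z : Set.Icc (0 : ℝ) T → Ω → EuclideanSpace ℝ (Fin d) :=
    fun t ω ↦ bridgeMean lam T b t + X t ω with hZ
  have hZm : ∀ t, Measurable (Z t) := fun t ↦ (hX.measurable t).const_add _
  have hcomap : ∀ τ, MeasurableSpace.comap (Z τ) inferInstance ≤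
      MeasurableSpace.comap (X τ) inferInstance := fun τ ↦
    Measurable.comap_le (Measurable.const_add (comap_measurable (X τ)) (bridgeMean lam T b τ))
  -- The interpolation of the positions, and its measurability.
  let I : Set.Icc (0 : ℝ) T → Set.Icc (0 : ℝ) T → Set.Icc (0 : ℝ) T → Ω →
      EuclideanSpace ℝ (Fin d) := fun s r t ω ↦
    (Real.sinh (lam * (t - r)) / Real.sinh (lam * (t - s))) • Z s ω +
      (Real.sinh (lam * (r - s)) / Real.sinh (lam * (t - s))) • Z t ω
  have hI : ∀ s r t, Measurable[presentField Z s ⊔ presentField Z t] (I s r t) := by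
    intro s r t
    have h1 : Measurable[presentField Z s ⊔ presentField Z t] (Z s) :=
      (measurable_presentField s).mono le_sup_left le_rfl
    have h2 : Measurable[presentField Z s ⊔ presentField Z t] (Z t) :=
      (measurable_presentField t).mono le_sup_right le_rfl
    exact (h1.const_smul (Real.sinh (lam * (t - r)) / Real.sinh (lam * (t - s)))).add
      (h2.const_smul (Real.sinh (lam * (r - s)) / Real.sinh (lam * (t - s))))
  have hdec : ∀ {s r t : Set.Icc (0 : ℝ) T}, s < r → r < t → ∀ ω,
      I s r t ω + interpolationError lam X s r t ω = Z r ω := by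
    intro s r t hsr hrt ω
    have h := bridgeMean_interpolation (T := T) (r := r) hlam b
      (show (s : ℝ) < t from hsr.trans hrt)
    simp only [I, hZ, interpolationError, h, smul_add]
    abel
  have hind : ∀ {s r t : Set.Icc (0 : ℝ) T}, s < r → r < t →
      Indep (pastField Z s ⊔ futureField Z t)
        (MeasurableSpace.comap (interpolationError lam X s r t) inferInstance) P :=
    fun hsr hrt ↦ indep_of_indep_of_le_left (hX.indep_interpolationError hlam hT hsr hrt).1
      (sup_le_sup (iSup₂_mono fun τ _ ↦ hcomap τ) (iSup₂_mono fun τ _ ↦ hcomap τ))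
  have hle : ∀ s t, presentField Z s ⊔ presentField Z t ≤ pastField Z s ⊔ futureField Z t :=
    fun s t ↦ sup_le_sup (presentField_le_pastField le_rfl) (presentField_le_futureField le_rfl)
  have hle1 : ∀ s t, pastField Z s ⊔ futureField Z t ≤ mΩ :=
    fun s t ↦ sup_le (pastField_le hZm s) (futureField_le hZm t)
  have hle2 : ∀ s t, presentField Z s ⊔ presentField Z t ≤ mΩ :=
    fun s t ↦ (hle s t).trans (hle1 s t)
  refine ⟨hZm, ?_, ?_, ?_⟩
  · rintro s r t hsr hrt f hf ⟨C, hC⟩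
    have hεm := hX.measurable_interpolationError s r t
    have h1 := condExp_comp_add_of_indep (P := P) (hle1 s t) ((hI s r t).mono (hle s t) le_rfl) hεm
      (hind hsr hrt) hf.stronglyMeasurable hC
    have h2 := condExp_comp_add_of_indep (P := P) (hle2 s t) (hI s r t) hεm
      (indep_of_indep_of_le_left (hind hsr hrt) (hle s t)) hf.stronglyMeasurable hC
    simp_rw [hdec hsr hrt] at h1 h2
    exact h1.trans h2.symm
  · intro s r t hsr hrt F hF
    have h2 := condExp_comp_add_of_indep (P := P) (hle2 s t) (hI s r t)
      (hX.measurable_interpolationError s r t)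
      (indep_of_indep_of_le_left (hind hsr hrt) (hle s t))
      (f := F.indicator fun _ ↦ (1 : ℝ)) (stronglyMeasurable_const.indicator hF) (C := 1)
      fun x ↦ by by_cases h : x ∈ F <;> simp [h]
    simp_rw [hdec hsr hrt, (hX.indep_interpolationError hlam hT hsr hrt).2] at h2
    refine h2.trans (ae_of_all _ fun ω ↦ ?_)
    beta_reduce
    rw [twoSidedTransition_mehlerKernel hlam hsr hrt _ _ hF, isoGaussian_real_eq_map,
      map_measureReal_apply (by fun_prop) hF]
    have h3 : (fun z ↦ F.indicator (fun _ ↦ (1 : ℝ)) (I s r t ω + z)) =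
        ((fun z ↦ I s r t ω + z) ⁻¹' F).indicator 1 := by
      rfl
    rw [h3, integral_indicator_one ((measurable_const_add _) hF)]
  · rw [endpointMeasure_bridge hlam hT]
    -- At both endpoints the variance vanishes, and the position is its mean.
    have hend : ∀ t : Set.Icc (0 : ℝ) T, bridgeVariance lam T t = 0 →
        Z t =ᵐ[P] fun _ ↦ bridgeMean lam T b t := by
      intro t ht
      have h1 : P.map (X t) = isoGaussian 0 0 :=
        HasGaussianLaw.map_eq_isoGaussian (hX.gaussian.hasGaussianLaw_eval t) le_rfl (hX.mean t)
          fun x ↦ by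
            rw [hX.covariance t t le_rfl]
            exact congrArg (· * inner ℝ x x) ht
      rw [isoGaussian_zero_left] at h1
      have h2 : HasLaw (X t) (Measure.dirac (0 : EuclideanSpace ℝ (Fin d))) P :=
        ⟨(hX.measurable t).aemeasurable, h1⟩
      filter_upwards [h2.ae_eq_of_dirac] with ω hω
      simp [hZ, hω]
    have h0 := hend ⟨0, Set.left_mem_Icc.2 hT.le⟩ (by simp [bridgeVariance])
    have h1 := hend ⟨T, Set.right_mem_Icc.2 hT.le⟩ (by simp [bridgeVariance])
    have h2 : (fun ω ↦ (Z ⟨0, Set.left_mem_Icc.2 hT.le⟩ ω, Z ⟨T, Set.right_mem_Icc.2 hT.le⟩ ω))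
        =ᵐ[P] fun _ ↦ (0, b) := by
      filter_upwards [h0, h1] with ω h0 h1
      rw [h0, h1, bridgeMean_zero, bridgeMean_self hlam hT]
    rw [Measure.map_congr h2, Measure.map_const, measure_univ, one_smul]

end IsCentredBridge

end GaussianBridge

/-! ### Existence of the bridge -/

section Existence

variable {d : ℕ} {T lam : ℝ}

lemma IsCentredBridge.comp_measurePreserving {Ω Ω' : Type*} {mΩ : MeasurableSpace Ω}
    {mΩ' : MeasurableSpace Ω'} {P : Measure Ω} {Q : Measure Ω'}
    {X : Set.Icc (0 : ℝ) T → Ω → EuclideanSpace ℝ (Fin d)} (hX : IsCentredBridge lam X P)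
    {π : Ω' → Ω} (hπ : MeasurePreserving π Q P) :
    IsCentredBridge lam (fun t ω ↦ X t (π ω)) Q where
  measurable t := (hX.measurable t).comp hπ.measurable
  gaussian := ⟨fun I ↦ ⟨by
    have hm : Measurable fun ω ↦ I.restrict (X · ω) :=
      measurable_pi_lambda _ fun t ↦ hX.measurable t
    have h := (hX.gaussian.hasGaussianLaw I).isGaussian_map
    rw [← hπ.map_eq, Measure.map_map hm hπ.measurable] at h
    exact h⟩⟩
  mean t x := by
    have h := hX.mean t x
    rwa [← hπ.map_eq, integral_map hπ.aemeasurable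
      ((hX.measurable t).const_inner).aestronglyMeasurable] at h
  covariance s t hst x y := by
    have h := hX.covariance s t hst x y
    rwa [← hπ.map_eq, integral_map hπ.aemeasurable
      (Measurable.fun_mul (hX.measurable s).const_inner
        (hX.measurable t).const_inner).aestronglyMeasurable] at h

/-- The time change under which the centred bridge, divided by `sinh (λ (T - t))`, is a Brownian motion.
At `t = T` its value is the junk value `0`. -/
def bridgeClock (lam T t : ℝ) : ℝ :=
  Real.sinh (lam * t) / (lam * Real.sinh (lam * T) * Real.sinh (lam * (T - t)))

lemma bridgeClock_nonneg (hlam : 0 < lam) {t : ℝ} (ht : 0 ≤ t) (htT : t ≤ T) :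
    0 ≤ bridgeClock lam T t := by
  have h1 := Real.sinh_nonneg_iff.2 (mul_nonneg hlam.le ht)
  have h2 := Real.sinh_nonneg_iff.2 (mul_nonneg hlam.le (sub_nonneg.2 htT))
  have h3 := Real.sinh_nonneg_iff.2 (mul_nonneg hlam.le (ht.trans htT))
  unfold bridgeClock
  positivity

lemma bridgeClock_le (hlam : 0 < lam) {s t : ℝ} (hs : 0 ≤ s) (hst : s ≤ t) (htT : t < T) :
    bridgeClock lam T s ≤ bridgeClock lam T t := by
  have h1 := Real.sinh_nonneg_iff.2 (mul_nonneg hlam.le (hs.trans hst))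
  have h2 := sinh_mul_pos hlam (sub_pos.2 htT)
  have h3 := sinh_mul_pos hlam (hs.trans_lt (hst.trans_lt htT))
  have h4 : Real.sinh (lam * s) ≤ Real.sinh (lam * t) :=
    Real.sinh_le_sinh.2 (mul_le_mul_of_nonneg_left hst hlam.le)
  have h5 : Real.sinh (lam * (T - t)) ≤ Real.sinh (lam * (T - s)) :=
    Real.sinh_le_sinh.2 (mul_le_mul_of_nonneg_left (by linarith) hlam.le)
  unfold bridgeClock
  gcongr

/-- The `L²` functions whose Wiener integrals are the components of the bridge. -/
def bridgeIntegrand (lam T t : ℝ) : EuclideanSpace ℝ (Fin d) →ₗ[ℝ]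
    Lp (EuclideanSpace ℝ (Fin d)) 2 (volume : Measure ℝ) where
  toFun x := indicatorConstLp 2 (measurableSet_Ioc (a := 0) (b := bridgeClock lam T t))
    measure_Ioc_lt_top.ne (Real.sinh (lam * (T - t)) • x)
  map_add' x y := by rw [smul_add, indicatorConstLp_add]
  map_smul' a x := by
    rw [smul_comm]
    ext1
    filter_upwards [indicatorConstLp_coeFn (p := 2) (μ := (volume : Measure ℝ))
        (hs := measurableSet_Ioc (a := 0) (b := bridgeClock lam T t))
        (hμs := measure_Ioc_lt_top.ne) (c := a • Real.sinh (lam * (T - t)) • x),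
      indicatorConstLp_coeFn (p := 2) (μ := (volume : Measure ℝ))
        (hs := measurableSet_Ioc (a := 0) (b := bridgeClock lam T t))
        (hμs := measure_Ioc_lt_top.ne) (c := Real.sinh (lam * (T - t)) • x),
      Lp.coeFn_smul a (indicatorConstLp 2 (μ := (volume : Measure ℝ))
        (measurableSet_Ioc (a := 0) (b := bridgeClock lam T t))
        measure_Ioc_lt_top.ne (Real.sinh (lam * (T - t)) • x))] with u h1 h2 h3
    rw [h1, RingHom.id_apply, h3, Pi.smul_apply, h2]
    by_cases h : u ∈ Set.Ioc 0 (bridgeClock lam T t) <;> simp [h]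

/-- For `s ≤ t < T` the intersection of the two intervals is the interval of `s`, the clock being
increasing; for `t = T` both sides vanish, whatever the value of the clock. -/
lemma inner_bridgeIntegrand (hlam : 0 < lam) {s t : ℝ} (hs : 0 ≤ s) (hst : s ≤ t) (htT : t ≤ T)
    (x y : EuclideanSpace ℝ (Fin d)) :
    inner ℝ (bridgeIntegrand lam T s x) (bridgeIntegrand lam T t y) =
      Real.sinh (lam * (T - t)) * Real.sinh (lam * s) / (lam * Real.sinh (lam * T)) *
        inner ℝ x y := by
  have h := L2.inner_indicatorConstLp_indicatorConstLp (𝕜 := ℝ) (μ := (volume : Measure ℝ))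
    (measurableSet_Ioc (a := 0) (b := bridgeClock lam T s))
    (measurableSet_Ioc (a := 0) (b := bridgeClock lam T t))
    measure_Ioc_lt_top.ne measure_Ioc_lt_top.ne
    (Real.sinh (lam * (T - s)) • x) (Real.sinh (lam * (T - t)) • y)
  refine h.trans ?_
  rw [inner_smul_left, inner_smul_right]
  rcases htT.lt_or_eq with htT | rfl
  · have h1 := sinh_mul_pos hlam (sub_pos.2 htT)
    have h2 := sinh_mul_pos hlam (sub_pos.2 (hst.trans_lt htT))
    have h3 := sinh_mul_pos hlam (hs.trans_lt (hst.trans_lt htT))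
    rw [Set.Ioc_inter_Ioc, sup_idem, inf_of_le_left (bridgeClock_le hlam hs hst htT),
      Real.volume_real_Ioc_of_le (bridgeClock_nonneg hlam hs (hst.trans htT.le)), bridgeClock]
    simp only [smul_eq_mul, sub_zero, conj_trivial]
    field_simp
  · simp

/-- The Wiener integrals of the functions in `bridgeIntegrand` form a centred bridge. -/
lemma exists_isCentredBridge (d : ℕ) (T : ℝ) (hlam : 0 < lam) :
    ∃ (Ω : Type) (_ : MeasurableSpace Ω) (P : Measure Ω)
      (X : Set.Icc (0 : ℝ) T → Ω → EuclideanSpace ℝ (Fin d)),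
      IsProbabilityMeasure P ∧ IsCentredBridge lam X P := by
  obtain ⟨Ω, mΩ, P, W, hP, hW⟩ :=
    exists_isonormal (Lp (EuclideanSpace ℝ (Fin d)) 2 (volume : Measure ℝ))
  let e : ℝ → Fin d → Lp (EuclideanSpace ℝ (Fin d)) 2 (volume : Measure ℝ) :=
    fun t i ↦ bridgeIntegrand lam T t (EuclideanSpace.single i 1)
  let X : Set.Icc (0 : ℝ) T → Ω → EuclideanSpace ℝ (Fin d) :=
    fun t ω ↦ WithLp.toLp 2 fun i ↦ W (e t i) ω
  have hXm : ∀ t, Measurable (X t) := fun t ↦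
    (WithLp.measurable_toLp 2 _).comp
      (measurable_pi_lambda _ fun i ↦ (Lp.stronglyMeasurable (W (e t i))).measurable)
  have hinner : ∀ t x, (fun ω ↦ inner ℝ x (X t ω)) =ᵐ[P] W (bridgeIntegrand lam T t x) := by
    intro t x
    have h1 : W (bridgeIntegrand lam T t x) = ∑ i, x i • W (e t i) := by
      conv_lhs => rw [← (EuclideanSpace.basisFun (Fin d) ℝ).sum_repr x]
      simp [e]
    have h2 : ∀ᵐ ω ∂P, ∀ i, (x i • W (e t i) : Lp ℝ 2 P) ω = x i * W (e t i) ω := by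
      rw [ae_all_iff]
      intro i
      filter_upwards [Lp.coeFn_smul (x i) (W (e t i))] with ω hω
      rw [hω]
      rfl
    rw [h1]
    filter_upwards [h2, Lp.coeFn_finsetSum Finset.univ
      fun i ↦ (x i • W (e t i) : Lp ℝ 2 P)] with ω h2 h3
    rw [h3, Finset.sum_apply, PiLp.inner_apply]
    refine Finset.sum_congr rfl fun i _ ↦ ?_
    rw [h2]
    simp [X, mul_comm]
  refine ⟨Ω, mΩ, P, X, hP, hXm, ?_, fun t x ↦ ?_, fun s t hst x y ↦ ?_⟩
  · classical
    have hgauss := isGaussianProcess_isonormal hW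
    refine hgauss.of_isGaussianProcess fun t ↦
      ⟨Finset.univ.image (e t),
        (PiLp.continuousLinearEquiv 2 ℝ fun _ : Fin d ↦ ℝ).symm.toContinuousLinearMap.comp
        (ContinuousLinearMap.pi fun i ↦ ContinuousLinearMap.proj (R := ℝ)
          (φ := fun _ : Finset.univ.image (e t) ↦ ℝ)
          ⟨e t i, Finset.mem_image_of_mem _ (Finset.mem_univ i)⟩), fun ω ↦ rfl⟩
  · have h : ∫ ω, W (bridgeIntegrand lam T t x) ω ∂P =
        ∫ z, z ∂(P.map (W (bridgeIntegrand lam T t x))) := by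
      rw [integral_map (Lp.aestronglyMeasurable _).aemeasurable (by fun_prop)]
    rw [integral_congr_ae (hinner t x), h, hW, integral_id_gaussianReal]
  · rw [integral_congr_ae ((hinner s x).fun_mul (hinner t y)),
      ← inner_bridgeIntegrand hlam s.2.1 hst t.2.2, ← W.inner_map_map, L2.inner_def]
    simp [mul_comm]

lemma measurePreserving_completion {Ω : Type*} {mΩ : MeasurableSpace Ω} (P : Measure Ω) :
    MeasurePreserving (β := Ω) (id : NullMeasurableSpace Ω P → Ω) P.completion P := by
  have hm : Measurable (β := Ω) (id : NullMeasurableSpace Ω P → Ω) :=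
    fun s hs ↦ MeasurableSet.nullMeasurableSet hs
  refine ⟨hm, ?_⟩
  ext s hs
  exact (Measure.map_apply hm hs).trans (Measure.completion_apply P s)

/-- The centred bridge is carried over to the completion of its probability space. -/
lemma exists_isOscillatorBridge (hlam : 0 < lam) (hT : 0 < T) (b : EuclideanSpace ℝ (Fin d)) :
    ∃ (Ω : Type) (_ : MeasurableSpace Ω) (P : Measure Ω)
      (Z : Set.Icc (0 : ℝ) T → Ω → EuclideanSpace ℝ (Fin d)),
      IsProbabilityMeasure P ∧ P.IsComplete ∧ IsOscillatorBridge hT lam b Z P := by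
  obtain ⟨Ω, mΩ, P, X, hP, hX⟩ := exists_isCentredBridge d T hlam
  exact ⟨NullMeasurableSpace Ω P, inferInstance, P.completion, _,
    ⟨(Measure.completion_apply P Set.univ).trans measure_univ⟩, inferInstance,
    (hX.comp_measurePreserving (measurePreserving_completion P)).isOscillatorBridge hlam hT b⟩

end Existence

end

theorem corollary3 (d : ℕ) (hd : 0 < d) (T : ℝ) (hT : 0 < T) (lam : ℝ) (hlam : 0 < lam)
    (b : (Fin d → ℕ) → EuclideanSpace ℝ (Fin d)) (m : Fin d → ℕ) :
    -- Mehler's kernel is a Green function for the harmonic oscillator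
    IsGreenFunction (d := d) (oscillatorPotential lam) T (mehlerKernel lam) ∧
    -- the bridge exists on some complete probability space
    (∃ (Ω : Type) (_ : MeasurableSpace Ω) (P : Measure Ω)
      (Z : Set.Icc (0 : ℝ) T → Ω → EuclideanSpace ℝ (Fin d)),
      IsProbabilityMeasure P ∧ P.IsComplete ∧ IsOscillatorBridge hT lam (b m) Z P) ∧
    -- every realization of the bridge has the stated properties
    (∀ (Ω : Type*) [MeasurableSpace Ω] (P : Measure Ω) [IsProbabilityMeasure P]
      (Z : Set.Icc (0 : ℝ) T → Ω → EuclideanSpace ℝ (Fin d)),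
      IsOscillatorBridge hT lam (b m) Z P →
        ¬ IsStationaryProcess Z P ∧
        IsGaussianProcess Z P ∧
        HasMarkovProperty Z P ∧
        -- one-dimensional distributions
        (∀ t : Set.Icc (0 : ℝ) T, (t : ℝ) ∈ Set.Ioo 0 T →
          ∀ F : Set (EuclideanSpace ℝ (Fin d)), MeasurableSet F →
            P.real (Z t ⁻¹' F) = ∫ x in F, bridgeDensity lam T (b m) t x) ∧
        -- pinning at the endpoints
        P {ω | Z ⟨0, Set.left_mem_Icc.2 hT.le⟩ ω = 0} = 1 ∧
        P {ω | Z ⟨T, Set.right_mem_Icc.2 hT.le⟩ ω = b m} = 1 ∧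
        -- mean
        (∀ t : Set.Icc (0 : ℝ) T,
          Integrable (Z t) P ∧ ∫ ω, Z t ω ∂P = bridgeMean lam T (b m) t) ∧
        -- covariance
        (∀ (s t : Set.Icc (0 : ℝ) T) (i j : Fin d),
          Integrable (fun ω ↦ (Z s ω i - bridgeMean lam T (b m) s i) *
            (Z t ω j - bridgeMean lam T (b m) t j)) P ∧
          (s ≤ t →
            ∫ ω, (Z s ω i - bridgeMean lam T (b m) s i) *
                (Z t ω j - bridgeMean lam T (b m) t j) ∂P =
              Real.sinh (lam * (T - t)) * Real.sinh (lam * s) / (lam * Real.sinh (lam * T)) *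
                (if i = j then 1 else 0)) ∧
          (t ≤ s →
            ∫ ω, (Z s ω i - bridgeMean lam T (b m) s i) *
                (Z t ω j - bridgeMean lam T (b m) t j) ∂P =
              Real.sinh (lam * (T - s)) * Real.sinh (lam * t) / (lam * Real.sinh (lam * T)) *
                (if i = j then 1 else 0))) ∧
        -- expectations of bounded observables
        (∀ f : EuclideanSpace ℝ (Fin d) → ℂ, Measurable f → (∃ C : ℝ, ∀ x, ‖f x‖ ≤ C) →
          ∀ t : Set.Icc (0 : ℝ) T, (t : ℝ) ∈ Set.Ioo 0 T →
            ∫ ω, f (Z t ω) ∂P = ∫ x, (bridgeDensity lam T (b m) t x : ℂ) * f x)) := by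
  refine ⟨isGreenFunction_mehlerKernel T hlam, exists_isOscillatorBridge hlam hT (b m), ?_⟩
  intro Ω _ P _ Z hZ
  have hdens : ∀ t x, bridgeDensity lam T (b m) t x =
      gaussDensity (bridgeVariance lam T t) (bridgeMean lam T (b m) t) x := fun _ _ ↦ rfl
  obtain ⟨h0, h1⟩ := hZ.ae_start_and_end hlam
  refine ⟨hZ.not_isStationaryProcess hd hlam, hZ.isGaussianProcess hlam,
    hZ.hasMarkovProperty hlam, fun t ht F hF ↦ ?_, ?_, ?_, fun t ↦ ⟨?_, hZ.integral_eq hlam t⟩,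
    fun s t i j ↦ ⟨hZ.integrable_mul hlam s t i j, fun hst ↦ hZ.covariance_eq hlam hst i j,
      fun hts ↦ ?_⟩, fun f hf _ t ht ↦ ?_⟩
  · simp_rw [hdens]
    rw [← isoGaussian_real_apply (bridgeVariance_pos hlam ht.1 ht.2) _ hF, ← hZ.map_eq hlam t,
      map_measureReal_apply (hZ.measurable t) hF]
  · exact (mem_ae_iff_prob_eq_one (hZ.measurable _ (measurableSet_singleton _))).1 h0
  · exact (mem_ae_iff_prob_eq_one (hZ.measurable _ (measurableSet_singleton _))).1 h1
  · exact ((hZ.isGaussianProcess hlam).hasGaussianLaw_eval t).integrable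
  · simp_rw [mul_comm (Z s _ i - _), hZ.covariance_eq hlam hts j i, eq_comm]
  · simp_rw [hdens]
    rw [← integral_map (hZ.measurable t).aemeasurable hf.aestronglyMeasurable, hZ.map_eq hlam t,
      integral_isoGaussian (bridgeVariance_pos hlam ht.1 ht.2)]
    rfl
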